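/- Setting. Fix integers $k\ge 0$, $0\le s<n<m$ with $k<n$ (partial key subscription) and rates $\lambda_s,\lambda_e>0$. A scalable homogeneous network with parameters $(n,s,m)$ consists of a source and $m$ receiver nodes, $s$ of which are subscribers. Source updates (versions) $\ell=1,2,\dots$ are generated at the jump times $\tau_\ell$ of a Poisson counter $N_0(t)$ with rate $\lambda_s$. For each ordered pair of distinct receivers $(i,j)$ the edge $i\to j$ is activated at the jumps of a Poisson counter with rate $\lambda_e/(m-1)$. At time $\tau_\ell$ the source encodes version $\ell$ into $n$ distinct keys, any $k+1$ of which suffice to decode it. It instantaneously gives one key to each subscriber and the remaining $n-s$ keys, one each, to the members of a uniformly random $(n-s)$-subset of the $m-s$ nonsubscribers. The random subsets for different versions and all the counters are mutually independent. Nodes have memory: when the edge $i\to j$ is activated, $i$ sends to $j$ all the keys that $i$ has received directly from the source since the previous activation of that edge (keys obtained from other nodes are not forwarded). Let $N_j^k(t)$ be the latest version of which node $j$ has at least $k+1$ keys at time $t$ ($0$ if there is none), and let $A_j(k,t)=N_0(t)-N_j^k(t)$. The version age of $k$-keys of node $j$ is $\lim_{t\to\infty}\frac1t\int_0^t A_j(k,u)\,du$.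 It is denoted $\Delta^{(k)}(n,s,m)$ if $j$ is a subscriber and $\Delta^{\dagger(k)}(n,s,m)$ if $j$ is a nonsubscriber. The same definitions are used for $(n,s,m)$ replaced by $(m,m,m)$ (full subscription) and $(n,n,m)$ (total key subscription). Theorem. With probability one these limits exist, and they are finite constants which depend only on $k$, the network parameters and the rates, and on $j$ only through whether $j$ is a subscriber. The average version age over the graph $$\Delta_G^{(k)}(n,s,m):=\frac{s}{m}\,\Delta^{(k)}(n,s,m)+\frac{m-s}{m}\,\Delta^{\dagger(k)}(n,s,m)$$ (the first term being $0$ if $s=0$) satisfies $$\Delta^{(k)}(m,m,m)\;\le\;\Delta_G^{(k)}(n,s,m)\;\le\;\Delta^{\dagger(k)}(n,n,m).$$ -/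

import Mathlib

open MeasureTheory ProbabilityTheory Filter Topology
open scoped NNReal

universe u

noncomputable section

namespace Gossip

/-- `N` is (almost surely) the path of a Poisson counter with rate `r`: it starts at `0`, its paths
are nondecreasing and right-continuous, and its increments are independent, the increment over
`(a, b]` being Poisson distributed with mean `r * (b - a)`. -/
structure IsPoissonCounter {Ω : Type u} [MeasurableSpace Ω] (N : ℝ≥0 → Ω → ℕ) (r : ℝ≥0)
    (μ : Measure Ω) : Prop where
  measurable : ∀ t, Measurable (N t)
  zero : ∀ᵐ ω ∂μ, N 0 ω = 0
  monotone : ∀ᵐ ω ∂μ, Monotone fun t => N t ω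
  rightContinuous : ∀ᵐ ω ∂μ, ∀ t, ContinuousWithinAt (fun v => N v ω) (Set.Ici t) t
  indepIncrements : HasIndepIncrements N μ
  law_increment : ∀ a b : ℝ≥0, a ≤ b →
    HasLaw (fun ω => N b ω - N a ω) (poissonMeasure (r * (b - a))) μ

/-- The counters of a fully connected network on the receiver nodes `Fin m`: the counter of the
updates of the source, and one activation counter for each directed edge `i → j`, `i ≠ j`. -/
inductive Counter (m : ℕ) : Type
  | source : Counter m
  | edge (i j : Fin m) (h : i ≠ j) : Counter m

/-- Source updates have rate `lamS`; every edge is activated at rate `lamE / (m - 1)`. -/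
def Counter.rate {m : ℕ} (lamS lamE : ℝ≥0) : Counter m → ℝ≥0
  | .source => lamS
  | .edge _ _ _ => lamE / ((m - 1 : ℕ) : ℝ≥0)

/-- A scalable homogeneous network on `m` receiver nodes with `s` subscribers, in which every
source update is encoded into `n` keys, realized on the probability space `(Ω, μ)`.
`selected ℓ` is the random set of the `n - s` nonsubscribers that receive a key of version `ℓ`. -/
structure Network (n s m : ℕ) (lamS lamE : ℝ≥0) {Ω : Type u} [MeasurableSpace Ω]
    (μ : Measure Ω) where
  subscribers : Finset (Fin m)
  card_subscribers : subscribers.card = s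
  counter : Counter m → ℝ≥0 → Ω → ℕ
  selected : ℕ → Ω → Finset (Fin m)
  poisson : ∀ c, IsPoissonCounter (counter c) (c.rate lamS lamE) μ
  measurable_selected : ∀ ℓ, Measurable (selected ℓ)
  law_selected : ∀ ℓ, HasLaw (selected ℓ)
    (uniformOn (↑(Finset.powersetCard (n - s) subscribersᶜ) : Set (Finset (Fin m)))) μ
  indep_counters : iIndepFun (fun c ω t => counter c t ω) μ
  indep_selected : iIndepFun selected μ
  indep_counters_selected :
    IndepFun (fun ω c t => counter c t ω) (fun ω ℓ => selected ℓ ω) μ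

namespace Network

variable {n s m : ℕ} {lamS lamE : ℝ≥0} {Ω : Type u} [MeasurableSpace Ω] {μ : Measure Ω}
  (G : Network n s m lamS lamE μ)

/-- The latest version `N₀(t)` available at the source at time `t`. -/
def sourceVersion (t : ℝ≥0) (ω : Ω) : ℕ := G.counter .source t ω

/-- The time at which version `ℓ` is generated; version `0` is present at time `0`. -/
def updateTime (ℓ : ℕ) (ω : Ω) : ℝ≥0 := sInf {t | ℓ ≤ G.sourceVersion t ω}

/-- The nodes that receive a key of version `ℓ` from the source when it is generated. -/
def keyHolders (ℓ : ℕ) (ω : Ω) : Finset (Fin m) := G.subscribers ∪ G.selected ℓ ω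

/-- The keys of version `ℓ` that node `j` has at a time `t` not before the generation of version
`ℓ`, in the scheme with memory, each key being named by the node that got it from the source.
Nodes pass on only keys that they got from the source. At an activation of the edge `i → j`, node
`i` sends `j` all those that it got since the previous activation, hence at time `t` node `j` has
the key that the source gave to `i ≠ j` iff that edge was activated after the generation of version
`ℓ` and not after `t`. -/
def keys (j : Fin m) (ℓ : ℕ) (t : ℝ≥0) (ω : Ω) : Set (Fin m) :=
  {i | i ∈ G.keyHolders ℓ ω ∧
    (i = j ∨ ∃ h : i ≠ j,
      G.counter (.edge i j h) (G.updateTime ℓ ω) ω < G.counter (.edge i j h) t ω)}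

/-- Node `j` can decode version `ℓ` at time `t`: this version has been generated and `j` has at
least `k + 1` of its keys. -/
def CanDecode (k : ℕ) (j : Fin m) (ℓ : ℕ) (t : ℝ≥0) (ω : Ω) : Prop :=
  ℓ ≤ G.sourceVersion t ω ∧ k + 1 ≤ (G.keys j ℓ t ω).ncard

/-- The latest version that node `j` can decode at time `t` (`0` as long as there is none). -/
def decodedVersion (k : ℕ) (j : Fin m) (t : ℝ≥0) (ω : Ω) : ℕ :=
  sSup {ℓ | G.CanDecode k j ℓ t ω}

/-- The `k`-keys version age `A_j(k, t)` of node `j` with memory. -/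
def age (k : ℕ) (j : Fin m) (t : ℝ≥0) (ω : Ω) : ℝ :=
  (G.sourceVersion t ω : ℝ) - (G.decodedVersion k j t ω : ℝ)

/-- The time average of the `k`-keys version age of node `j` exists and equals `a`, with
probability one. -/
def HasTimeAverageAge (k : ℕ) (j : Fin m) (a : ℝ) : Prop :=
  ∀ᵐ ω ∂μ,
    (∀ t : ℝ, IntervalIntegrable (fun v : ℝ => G.age k j v.toNNReal ω) volume 0 t) ∧
    Tendsto (fun t : ℝ => (1 / t) * ∫ v in (0 : ℝ)..t, G.age k j v.toNNReal ω) atTop (𝓝 a)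

end Network

/-- `a` is the version age of `k`-keys of subscriber nodes with memory: in every network with these
parameters, each subscriber has time average age `a` almost surely. -/
def IsSubscriberAge (k n s m : ℕ) (lamS lamE : ℝ≥0) (a : ℝ) : Prop :=
  ∀ (Ω : Type u) [MeasurableSpace Ω] (μ : Measure Ω) [IsProbabilityMeasure μ]
    (G : Network n s m lamS lamE μ), ∀ j ∈ G.subscribers, G.HasTimeAverageAge k j a

/-- `a` is the version age of `k`-keys of nonsubscriber nodes with memory: in every network with
these parameters, each nonsubscriber has time average age `a` almost surely. -/
def IsNonsubscriberAge (k n s m : ℕ) (lamS lamE : ℝ≥0) (a : ℝ) : Prop :=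
  ∀ (Ω : Type u) [MeasurableSpace Ω] (μ : Measure Ω) [IsProbabilityMeasure μ]
    (G : Network n s m lamS lamE μ), ∀ j ∉ G.subscribers, G.HasTimeAverageAge k j a

/-- The average version age over the graph, `a` and `b` being the version ages of the `s`
subscribers and of the `m - s` nonsubscribers. -/
def graphAverage (s m : ℕ) (a b : ℝ) : ℝ :=
  (s : ℝ) / m * a + ((m : ℝ) - s) / m * b

end Gossip

end

noncomputable section

namespace Gossip

open scoped ENNReal

/-! The time average is the limit of the mean age, and the two inequalities are proved for the mean
age at each fixed time.

Existence. Forget everything that happened up to a time `a`. The age at `a + d` is at least the age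
counted in the restarted network, and exceeds it by at most the age at `a`, with no excess once
every edge into `j` has fired in `(a, a + d]` (`versionAge_shift_le`, `versionAge_le_shift_add`).
The restarted network is independent of the past and has the original law (`indepFun_past_future`,
`map_path_selected_eq`). Hence the mean age increases with time; the second moment satisfies a
contracting recursion and stays bounded (`exists_secondMoment_le`); and covariances decay
exponentially, because an edge stays silent for a time `d` with exponentially small probability
(`covariance_pathAge_le`). A strong law for such correlated variables gives the averages along every
grid of mesh `1 / (p + 1)`. Since the age is a difference of two monotone functions, the Riemann
sums control the integral (`tendsto_time_average`). The limit `limitAge` depends on the law only,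
and relabelling the nodes shows that it depends on `j` only through membership in the subscribers
(`limitAge_congr`).

Lower bound. On the same counters, handing a key to every node can only lower the age
(`limitAge_fixed_univ_le`).

Upper bound. The age is at most the number of undecoded versions, with equality when all versions
have the same key holders, since then decoding a version implies decoding all older ones. So the
expected counts may be compared version by version. The holders of one version are independent of
the counters; for a fixed holder set the failure probability depends only on its size and on whether
it contains `j`, and replacing `j` by another node can only hurt (`measure_undecoded_le`). This
gives `limitAge_le_fixed`.

Both bounds hold for every node, so they hold for the weighted average of the two kinds of node. -/

/-- A finite set of times lies on a monotone sequence of times. -/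
lemma exists_monotone_enumeration (F : Finset ℝ≥0) :
    ∃ (t : ℕ → ℝ≥0) (idx : ℝ≥0 → ℕ), Monotone t ∧ Monotone idx ∧ ∀ x ∈ F, t (idx x) = x := by
  classical
  -- The rank of `x` in `F`; the sequence sends `i` to the largest element of `F` of rank at most
  -- `i`.
  let idx : ℝ≥0 → ℕ := fun x => (F.filter (· < x)).card
  refine ⟨fun i => (F.filter (fun x => idx x ≤ i)).sup id, idx, ?_, ?_, ?_⟩
  · intro i j hij
    refine Finset.sup_mono fun x hx => ?_
    simp only [Finset.mem_filter] at hx ⊢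
    exact ⟨hx.1, hx.2.trans hij⟩
  · intro x y hxy
    refine Finset.card_le_card fun z hz => ?_
    simp only [Finset.mem_filter] at hz ⊢
    exact ⟨hz.1, hz.2.trans_le hxy⟩
  · intro x hx
    refine le_antisymm (Finset.sup_le fun y hy => ?_) ?_
    · simp only [Finset.mem_filter] at hy
      by_contra hlt
      have hlt : x < y := not_le.1 hlt
      have : idx x < idx y := by
        refine Finset.card_lt_card ((Finset.ssubset_iff_of_subset fun z hz => ?_).2 ⟨x, ?_, ?_⟩)
        · simp only [Finset.mem_filter] at hz ⊢
          exact ⟨hz.1, hz.2.trans hlt⟩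
        · simp [hx, hlt]
        · simp
      omega
    · exact Finset.le_sup (f := id) (by simp [hx])

lemma sum_Ico_sub_of_monotone {f : ℕ → ℕ} (hf : Monotone f) {i j : ℕ} (hij : i ≤ j) :
    ∑ l ∈ Finset.Ico i j, (f (l + 1) - f l) = f j - f i := by
  induction j, hij using Nat.le_induction with
  | base => simp
  | succ j hij ih =>
    rw [Finset.sum_Ico_succ_top hij, ih]
    have := hf hij
    have := hf (Nat.le_succ j)
    simp only [Nat.succ_eq_add_one] at this
    omega

/-! ### Poisson counters: law on path space, independence of past and future, restarting -/

namespace IsPoissonCounter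

variable {Ω Ω' : Type*} [MeasurableSpace Ω] [MeasurableSpace Ω'] {N : ℝ≥0 → Ω → ℕ}
  {N' : ℝ≥0 → Ω' → ℕ} {r : ℝ≥0} {μ : Measure Ω} {μ' : Measure Ω'}

lemma ae_eq_sum (h : IsPoissonCounter N r μ) {t : ℕ → ℝ≥0} (ht : Monotone t) :
    ∀ᵐ ω ∂μ, ∀ i j, i ≤ j →
      N (t j) ω - N (t i) ω = ∑ l ∈ Finset.Ico i j, (N (t (l + 1)) ω - N (t l) ω) := by
  filter_upwards [h.monotone] with ω hω i j hij
  exact (sum_Ico_sub_of_monotone (f := fun l => N (t l) ω) (fun a b hab => hω (ht hab)) hij).symm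

lemma measurable_increment (h : IsPoissonCounter N r μ) (a b : ℝ≥0) :
    Measurable fun ω => N b ω - N a ω :=
  (h.measurable b).sub (h.measurable a)

lemma measurable_path (h : IsPoissonCounter N r μ) : Measurable fun ω t => N t ω :=
  measurable_pi_lambda _ h.measurable

/-- This product form involves only the rate and the grid, which is why the rate determines the
finite-dimensional laws. -/
lemma map_increments [IsProbabilityMeasure μ] (h : IsPoissonCounter N r μ) {t : ℕ → ℝ≥0}
    (ht : Monotone t) :
    μ.map (fun ω (i : ℕ) => N (t (i + 1)) ω - N (t i) ω) =
      Measure.infinitePi fun i => poissonMeasure (r * (t (i + 1) - t i)) := by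
  rw [(h.indepIncrements.nat ht).map_fun_eq_infinitePi_map
    (fun i => h.measurable_increment _ _)]
  congr 1
  funext i
  exact (h.law_increment _ _ (ht (Nat.le_succ i))).map_eq

/-- The finite dimensional laws of a Poisson counter. -/
lemma map_restrict [IsProbabilityMeasure μ] (h : IsPoissonCounter N r μ) {t : ℕ → ℝ≥0}
    {idx : ℝ≥0 → ℕ} (ht : Monotone t) (hidx : Monotone idx) {I : Finset ℝ≥0}
    (htidx : ∀ x ∈ insert 0 I, t (idx x) = x) :
    μ.map (fun ω => I.restrict (fun s => N s ω)) =
      (Measure.infinitePi fun i => poissonMeasure (r * (t (i + 1) - t i))).map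
        (fun x (s : I) => ∑ l ∈ Finset.Ico (idx 0) (idx s), x l) := by
  rw [← h.map_increments ht, Measure.map_map]
  · refine Measure.map_congr ?_
    filter_upwards [h.ae_eq_sum ht, h.zero] with ω hω h0
    funext s
    have := hω (idx 0) (idx s) (hidx (zero_le))
    rw [htidx 0 (by simp), htidx s (by simp), h0, Nat.sub_zero] at this
    simpa using this
  · exact measurable_pi_lambda _ fun s => Finset.measurable_sum _ fun l _ => measurable_pi_apply l
  · exact measurable_pi_lambda _ fun i => h.measurable_increment _ _

/-- The law of a Poisson counter on the space of paths is determined by its rate. -/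
theorem map_path_eq [IsProbabilityMeasure μ] [IsProbabilityMeasure μ']
    (h : IsPoissonCounter N r μ) (h' : IsPoissonCounter N' r μ') :
    μ.map (fun ω t => N t ω) = μ'.map (fun ω t => N' t ω) := by
  have key := isProjectiveLimit_map (P := μ) (X := N) h.measurable_path.aemeasurable
  have key' := isProjectiveLimit_map (P := μ') (X := N') h'.measurable_path.aemeasurable
  have hfd : (fun I : Finset ℝ≥0 => μ.map (fun ω => I.restrict (fun s => N s ω))) =
      fun I => μ'.map (fun ω => I.restrict (fun s => N' s ω)) := by
    funext I
    -- One grid serves both counters, so both marginals become the image of the same product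
    -- measure. Time `0` is included because values are recovered as increments from it.
    obtain ⟨t, idx, ht, hidx, hti⟩ := exists_monotone_enumeration (insert 0 I)
    rw [h.map_restrict ht hidx hti, h'.map_restrict ht hidx hti]
  rw [hfd] at key
  exact key.unique key'

/-- The past of a Poisson counter is independent of its increments after a given time. -/
theorem indepFun_past_future [IsProbabilityMeasure μ] (h : IsPoissonCounter N r μ) (a : ℝ≥0) :
    IndepFun (fun ω s => N (min s a) ω) (fun ω s => N (a + s) ω - N a ω) μ := by
  refine IndepFun.process_indepFun_process (fun s => h.measurable _)
    (fun s => h.measurable_increment _ _) fun I J => ?_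
  classical
  let F := insert 0 (insert a (I.image (fun s => min s a) ∪ J.image (fun s => a + s)))
  have hI : ∀ s ∈ I, min s a ∈ F := fun s hs => Finset.mem_insert_of_mem (Finset.mem_insert_of_mem
    (Finset.mem_union_left _ (Finset.mem_image_of_mem (fun s => min s a) hs)))
  have hJ : ∀ s ∈ J, a + s ∈ F := fun s hs => Finset.mem_insert_of_mem (Finset.mem_insert_of_mem
    (Finset.mem_union_right _ (Finset.mem_image_of_mem (fun s => a + s) hs)))
  obtain ⟨t, idx, ht, hidx, hti⟩ := exists_monotone_enumeration F
  have hind := h.indepIncrements.nat ht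
  have hsum := h.ae_eq_sum ht
  -- All past values are sums of increments with index below `idx a`, all future increments are sums
  -- over indices in `[idx a, M)`. Independence of these two disjoint blocks is what is needed.
  let M := J.sup (fun s => idx (a + s))
  have hd : Disjoint (Finset.Ico (idx 0) (idx a)) (Finset.Ico (idx a) M) :=
    Finset.Ico_disjoint_Ico_consecutive _ _ _
  have hST := hind.indepFun_finset _ _ hd (fun i => h.measurable_increment _ _)
  have hST2 := hST.comp
    (φ := fun x (s : I) => ∑ l : Finset.Ico (idx 0) (idx a),
      if (l : ℕ) < idx (min s a) then x l else 0)
    (ψ := fun x (s : J) => ∑ l : Finset.Ico (idx a) M, if (l : ℕ) < idx (a + s) then x l else 0)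
    (measurable_pi_lambda _ fun s => Finset.measurable_sum _ fun l _ => by
      split_ifs
      · exact measurable_pi_apply l
      · exact measurable_const)
    (measurable_pi_lambda _ fun s => Finset.measurable_sum _ fun l _ => by
      split_ifs
      · exact measurable_pi_apply l
      · exact measurable_const)
  refine hST2.congr ?_ ?_
  · filter_upwards [hsum, h.zero] with ω hω h0
    funext s
    have e := hω (idx 0) (idx (min s a)) (hidx (zero_le))
    rw [hti 0 (by simp [F]), hti _ (hI s s.2), h0, Nat.sub_zero] at e
    rw [e]
    simp only [Function.comp]
    rw [Finset.sum_coe_sort (Finset.Ico (idx 0) (idx a)) (fun l =>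
      if l < idx (min s a) then N (t (l + 1)) ω - N (t l) ω else 0), ← Finset.sum_filter]
    refine Finset.sum_congr ?_ fun _ _ => rfl
    ext l
    have := hidx (min_le_right (s : ℝ≥0) a)
    simp only [Finset.mem_filter, Finset.mem_Ico]
    omega
  · filter_upwards [hsum] with ω hω
    funext s
    have e := hω (idx a) (idx (a + s)) (hidx le_self_add)
    rw [hti a (by simp [F]), hti _ (hJ s s.2)] at e
    rw [e]
    simp only [Function.comp]
    rw [Finset.sum_coe_sort (Finset.Ico (idx a) M) (fun l =>
      if l < idx (a + s) then N (t (l + 1)) ω - N (t l) ω else 0), ← Finset.sum_filter]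
    refine Finset.sum_congr ?_ fun _ _ => rfl
    ext l
    have : idx (a + s) ≤ M := Finset.le_sup (f := fun s => idx (a + s)) s.2
    simp only [Finset.mem_filter, Finset.mem_Ico]
    omega

/-- A Poisson counter restarted at a given time is a Poisson counter. -/
theorem shift (h : IsPoissonCounter N r μ) (a : ℝ≥0) :
    IsPoissonCounter (fun t ω => N (a + t) ω - N a ω) r μ where
  measurable t := h.measurable_increment _ _
  zero := by simp
  monotone := by
    filter_upwards [h.monotone] with ω hω s t hst
    exact Nat.sub_le_sub_right (hω (by simpa using hst)) _
  rightContinuous := by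
    filter_upwards [h.rightContinuous] with ω hω t
    have h1 : Tendsto (fun v => a + v) (𝓝[Set.Ici t] t) (𝓝[Set.Ici (a + t)] (a + t)) := by
      refine tendsto_nhdsWithin_iff.2 ⟨?_, ?_⟩
      · exact ((continuous_const.add continuous_id).tendsto t).mono_left nhdsWithin_le_nhds
      · filter_upwards [self_mem_nhdsWithin] with v hv
        simpa using hv
    have h2 := (hω (a + t)).tendsto.comp h1
    exact (continuous_of_discreteTopology (f := fun x : ℕ => x - N a ω)).continuousAt.tendsto.comp
      h2
  indepIncrements := by
    intro n t ht
    have := h.indepIncrements n (fun i => a + t i) (fun i j hij => by simpa using ht hij)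
    refine this.congr fun i => ?_
    filter_upwards [h.monotone] with ω hω
    have h1 : N a ω ≤ N (a + t i.castSucc) ω := hω le_self_add
    have h2 : N (a + t i.castSucc) ω ≤ N (a + t i.succ) ω :=
      hω (by simpa using ht (Fin.castSucc_le_succ i))
    omega
  law_increment x y hxy := by
    have := h.law_increment (a + x) (a + y) (by simpa using hxy)
    rw [add_tsub_add_eq_tsub_left] at this
    refine this.congr ?_
    filter_upwards [h.monotone] with ω hω
    have h1 : N a ω ≤ N (a + x) ω := hω le_self_add
    have h2 : N (a + x) ω ≤ N (a + y) ω := hω (by simpa using hxy)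
    omega

end IsPoissonCounter

/-! ### Deterministic analysis of the age along one path -/

open scoped Classical

variable {m : ℕ}

/-- A path of the family of counters. -/
abbrev Path (m : ℕ) : Type := Counter m → ℝ≥0 → ℕ

namespace Path

/-- Node `j` has at time `t` what node `i` got from the source with version `ℓ`. Activation times
are separated by rational times, which makes this a measurable property of the path. -/
def Reaches (N : Path m) (ℓ : ℕ) (t : ℝ≥0) (i j : Fin m) : Prop :=
  i = j ∨ ∃ h : i ≠ j, ∃ r : ℚ≥0, (r : ℝ≥0) ≤ t ∧ ℓ ≤ N .source r ∧
    N (.edge i j h) r < N (.edge i j h) t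

/-- The nodes whose key of version `ℓ`, if they hold one, is known to `j` at time `t`. -/
def reaching (N : Path m) (ℓ : ℕ) (t : ℝ≥0) (j : Fin m) : Finset (Fin m) :=
  Finset.univ.filter fun i => N.Reaches ℓ t i j

/-- With the key holders `H ℓ` of version `ℓ`, node `j` can decode version `ℓ` at time `t`. -/
def Decodes (k : ℕ) (j : Fin m) (N : Path m) (H : ℕ → Finset (Fin m)) (t : ℝ≥0) (ℓ : ℕ) : Prop :=
  k + 1 ≤ (H ℓ ∩ N.reaching ℓ t j).card

/-- The latest version decoded by `j` at time `t`. -/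
def decoded (k : ℕ) (j : Fin m) (N : Path m) (H : ℕ → Finset (Fin m)) (t : ℝ≥0) : ℕ :=
  Nat.findGreatest (Decodes k j N H t) (N .source t)

/-- The version age of `j` at time `t`. -/
def versionAge (k : ℕ) (j : Fin m) (N : Path m) (H : ℕ → Finset (Fin m)) (t : ℝ≥0) : ℕ :=
  N .source t - decoded k j N H t

/-- Some edge into `j` is not activated in `(a, t]`. -/
def Silent (N : Path m) (j : Fin m) (a t : ℝ≥0) : Prop :=
  ∃ i, ∃ h : i ≠ j, N (.edge i j h) t ≤ N (.edge i j h) a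

/-- The path after time `a`. -/
def shift (N : Path m) (a : ℝ≥0) : Path m := fun c s => N c (a + s) - N c a

/-- The path stopped at time `a`. -/
def upTo (N : Path m) (a : ℝ≥0) : Path m := fun c s => N c (min s a)

variable {k : ℕ} {j : Fin m} {N : Path m} {H H' : ℕ → Finset (Fin m)} {s t a : ℝ≥0} {ℓ : ℕ}

lemma mem_reaching {i : Fin m} : i ∈ N.reaching ℓ t j ↔ N.Reaches ℓ t i j := by
  simp [reaching]

lemma decoded_le : decoded k j N H t ≤ N .source t := Nat.findGreatest_le _

lemma versionAge_le : versionAge k j N H t ≤ N .source t := Nat.sub_le _ _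

lemma versionAge_add_decoded : versionAge k j N H t + decoded k j N H t = N .source t :=
  Nat.sub_add_cancel decoded_le

lemma le_decoded (h : Decodes k j N H t ℓ) (hℓ : ℓ ≤ N .source t) : ℓ ≤ decoded k j N H t :=
  Nat.le_findGreatest hℓ h

lemma decodes_decoded (h : decoded k j N H t ≠ 0) :
    Decodes k j N H t (decoded k j N H t) := Nat.findGreatest_of_ne_zero rfl h

lemma reaching_mono_time (hN : ∀ c, Monotone (N c)) (hst : s ≤ t) :
    N.reaching ℓ s j ⊆ N.reaching ℓ t j := by
  intro i
  simp only [mem_reaching]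
  rintro (h | ⟨h, r, h1, h2, h3⟩)
  · exact Or.inl h
  · exact Or.inr ⟨h, r, h1.trans hst, h2, h3.trans_le (hN _ hst)⟩

/-- An activation after a newer version appeared is also one after an older version appeared. With
constant key holders this makes the decoded versions an initial segment. -/
lemma reaching_anti_version {ℓ' : ℕ} (hℓ : ℓ ≤ ℓ') : N.reaching ℓ' t j ⊆ N.reaching ℓ t j := by
  intro i
  simp only [mem_reaching]
  rintro (h | ⟨h, r, h1, h2, h3⟩)
  · exact Or.inl h
  · exact Or.inr ⟨h, r, h1, hℓ.trans h2, h3⟩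

lemma Decodes.mono_time (hN : ∀ c, Monotone (N c)) (hst : s ≤ t) (h : Decodes k j N H s ℓ) :
    Decodes k j N H t ℓ :=
  le_trans h (Finset.card_le_card (Finset.inter_subset_inter_left (reaching_mono_time hN hst)))

lemma decoded_mono (hN : ∀ c, Monotone (N c)) : Monotone (decoded k j N H) := by
  intro s t hst
  by_cases h0 : decoded k j N H s = 0
  · simp [h0]
  · exact le_decoded ((decodes_decoded h0).mono_time hN hst) (decoded_le.trans (hN _ hst))

lemma versionAge_anti_holders (h : ∀ ℓ, 1 ≤ ℓ → H ℓ ⊆ H' ℓ) :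
    versionAge k j N H' t ≤ versionAge k j N H t := by
  refine Nat.sub_le_sub_left ?_ _
  by_cases h0 : decoded k j N H t = 0
  · simp [h0]
  · exact le_decoded (le_trans (decodes_decoded h0) (Finset.card_le_card
      (Finset.inter_subset_inter_right (h _ (by omega))))) decoded_le

lemma versionAge_congr_holders (h : ∀ ℓ, 1 ≤ ℓ → ℓ ≤ N .source t → H ℓ = H' ℓ) :
    versionAge k j N H t = versionAge k j N H' t := by
  have key : ∀ {H H' : ℕ → Finset (Fin m)}, (∀ ℓ, 1 ≤ ℓ → ℓ ≤ N .source t → H ℓ = H' ℓ) →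
      decoded k j N H t ≤ decoded k j N H' t := by
    intro H H' h
    by_cases h0 : decoded k j N H t = 0
    · simp [h0]
    · have h1 := decodes_decoded h0
      rw [Decodes, h _ (by omega) decoded_le] at h1
      exact le_decoded h1 decoded_le
  rw [versionAge, versionAge,
    le_antisymm (key h) (key fun ℓ h1 h2 => (h ℓ h1 h2).symm)]

/-- A node which is reached by all the edges after time `a` knows all the keys of the versions
generated up to time `a`. -/
lemma reaching_eq_univ {a : ℚ≥0} (hat : (a : ℝ≥0) ≤ t) (h : ¬ N.Silent j a t)
    (hℓ : ℓ ≤ N .source a) : N.reaching ℓ t j = Finset.univ := by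
  ext i
  simp only [mem_reaching, Finset.mem_univ, iff_true]
  by_cases hij : i = j
  · exact Or.inl hij
  · refine Or.inr ⟨hij, a, hat, hℓ, ?_⟩
    by_contra h2
    exact h ⟨i, hij, not_lt.1 h2⟩

/-- With no silent edge, every holder's key of version `N .source a` has been passed on to `j`, so
all its keys are there. Version `0` is treated apart because `hH` concerns actual versions only. -/
lemma le_decoded_of_not_silent {a : ℚ≥0} (hN : ∀ c, Monotone (N c)) (hat : (a : ℝ≥0) ≤ t)
    (h : ¬ N.Silent j a t) (hH : ∀ ℓ, 1 ≤ ℓ → k + 1 ≤ (H ℓ).card) :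
    N .source a ≤ decoded k j N H t := by
  by_cases h0 : N .source a = 0
  · simp [h0]
  · refine le_decoded ?_ (hN _ hat)
    rw [Decodes, reaching_eq_univ hat h le_rfl, Finset.inter_univ]
    exact hH _ (by omega)

/-- A version later than `N .source a` does not exist before time `a`, so a rational time witnessing
the activation is at least `a`. Rationality of `a` keeps witnesses rational under translation. -/
lemma reaching_shift (hN : ∀ c, Monotone (N c)) (a : ℚ≥0) (hℓ : 1 ≤ ℓ) :
    (N.shift a).reaching ℓ s j = N.reaching (N .source a + ℓ) (a + s) j := by
  ext i
  simp only [mem_reaching, Reaches, shift]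
  refine or_congr Iff.rfl (exists_congr fun h => ⟨?_, ?_⟩)
  · rintro ⟨r, h1, h2, h3⟩
    have e1 : N .source a ≤ N .source (a + r) := hN _ le_self_add
    have e2 : N (.edge i j h) a ≤ N (.edge i j h) (a + r) := hN _ le_self_add
    refine ⟨a + r, ?_, ?_, ?_⟩
    · push_cast
      gcongr
    · push_cast
      omega
    · push_cast
      omega
  · rintro ⟨r, h1, h2, h3⟩
    have har : a ≤ r := by
      by_contra hlt
      have : N .source r ≤ N .source a :=
        hN _ (by exact_mod_cast (not_le.1 hlt).le)
      omega
    obtain ⟨q, rfl⟩ := exists_add_of_le har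
    push_cast at h1 h2 h3
    have e2 : N (.edge i j h) a ≤ N (.edge i j h) (a + q) := hN _ le_self_add
    refine ⟨q, by simpa using h1, by omega, by omega⟩

lemma decodes_shift (hN : ∀ c, Monotone (N c)) (a : ℚ≥0) (hℓ : 1 ≤ ℓ) :
    Decodes k j (N.shift a) (fun ℓ => H (N .source a + ℓ)) s ℓ ↔
      Decodes k j N H (a + s) (N .source a + ℓ) := by
  rw [Decodes, Decodes, reaching_shift hN a hℓ]

lemma shift_source_le : (N.shift a) .source s = N .source (a + s) - N .source a := rfl

/-- As soon as some version newer than time `a` is decoded, the older ones are irrelevant to the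
maximum. -/
lemma decoded_shift (hN : ∀ c, Monotone (N c)) (a : ℚ≥0)
    (h : decoded k j (N.shift a) (fun ℓ => H (N .source a + ℓ)) s ≠ 0) :
    decoded k j N H (a + s) =
      N .source a + decoded k j (N.shift a) (fun ℓ => H (N .source a + ℓ)) s := by
  set D := decoded k j (N.shift a) (fun ℓ => H (N .source a + ℓ)) s with hD
  have hle : D ≤ N .source (a + s) - N .source a := decoded_le
  have e1 : N .source a ≤ N .source (a + s) := hN _ le_self_add
  have h1 : N .source a + D ≤ decoded k j N H (a + s) :=
    le_decoded ((decodes_shift hN a (by omega)).1 (decodes_decoded h)) (by omega)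
  refine le_antisymm ?_ h1
  obtain ⟨d, hd⟩ := exists_add_of_le (le_trans le_self_add h1)
  have h0 : decoded k j N H (a + s) ≠ 0 := by omega
  have h2 := decodes_decoded h0
  have h3 : decoded k j N H (a + s) ≤ N .source (a + s) := decoded_le
  rw [hd] at h2 h3 ⊢
  have h4 : d ≤ D := by
    refine le_decoded ((decodes_shift hN a (by omega)).2 h2) ?_
    rw [shift_source_le]
    omega
  omega

/-- Versions generated up to time `a` can only increase the age. -/
lemma versionAge_shift_le (hN : ∀ c, Monotone (N c)) (a : ℚ≥0) :
    versionAge k j (N.shift a) (fun ℓ => H (N .source a + ℓ)) s ≤ versionAge k j N H (a + s) := by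
  have e1 : N .source a ≤ N .source (a + s) := hN _ le_self_add
  have h3 : decoded k j N H (a + s) ≤ N .source (a + s) := decoded_le
  have hle : decoded k j (N.shift a) (fun ℓ => H (N .source a + ℓ)) s ≤
    N .source (a + s) - N .source a := decoded_le
  by_cases h : decoded k j (N.shift a) (fun ℓ => H (N .source a + ℓ)) s = 0
  · by_cases h' : decoded k j N H (a + s) ≤ N .source a
    · rw [versionAge, versionAge, shift_source_le, h]
      omega
    · exfalso
      obtain ⟨d, hd⟩ := exists_add_of_le (not_le.1 h').le
      have h2 := decodes_decoded (k := k) (j := j) (N := N) (H := H) (t := a + s) (by omega)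
      rw [hd] at h2
      have : d ≤ decoded k j (N.shift a) (fun ℓ => H (N .source a + ℓ)) s := by
        refine le_decoded ((decodes_shift hN a (by omega)).2 h2) ?_
        rw [shift_source_le]
        omega
      omega
  · have := decoded_shift hN a h
    rw [versionAge, versionAge, shift_source_le]
    omega

/-- The age is at most the age due to the versions generated after time `a`, plus the age at
time `a` unless all the edges into `j` have been activated meanwhile. -/
lemma versionAge_le_shift_add (hN : ∀ c, Monotone (N c)) (a : ℚ≥0)
    (hH : ∀ ℓ, 1 ≤ ℓ → k + 1 ≤ (H ℓ).card) :
    versionAge k j N H (a + s) ≤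
      versionAge k j (N.shift a) (fun ℓ => H (N .source a + ℓ)) s +
        if N.Silent j a (a + s) then versionAge k j N H a else 0 := by
  have e1 : N .source a ≤ N .source (a + s) := hN _ le_self_add
  have h3 : decoded k j N H (a + s) ≤ N .source (a + s) := decoded_le
  have hle : decoded k j (N.shift a) (fun ℓ => H (N .source a + ℓ)) s ≤
    N .source (a + s) - N .source a := decoded_le
  -- If no version newer than `a` is decoded, the restarted age is the whole source increment. What
  -- remains to be paid is the age at `a`, or nothing if version `N .source a` is decoded by then.
  by_cases h : decoded k j (N.shift a) (fun ℓ => H (N .source a + ℓ)) s = 0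
  · simp only [versionAge, shift_source_le, h]
    split_ifs with hs
    · have h4 : decoded k j N H a ≤ decoded k j N H (a + s) := decoded_mono hN le_self_add
      have h5 : decoded k j N H a ≤ N .source a := decoded_le
      omega
    · have h4 := le_decoded_of_not_silent hN le_self_add hs hH
      omega
  · have := decoded_shift hN a h
    simp only [versionAge, shift_source_le]
    omega

lemma versionAge_le_increment (a : ℝ≥0) :
    versionAge k j (N.shift a) H s ≤ N .source (a + s) - N .source a := versionAge_le

lemma reaching_upTo (hta : t ≤ a) : (N.upTo a).reaching ℓ t j = N.reaching ℓ t j := by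
  ext i
  simp only [mem_reaching, Reaches, upTo]
  refine or_congr Iff.rfl (exists_congr fun h => exists_congr fun r => and_congr_right fun h1 => ?_)
  rw [min_eq_left hta, min_eq_left (h1.trans hta)]

lemma versionAge_upTo (hta : t ≤ a) : versionAge k j (N.upTo a) H t = versionAge k j N H t := by
  have h1 : (N.upTo a) .source t = N .source t := by simp [upTo, hta]
  have h2 : Decodes k j (N.upTo a) H t = Decodes k j N H t := by
    funext ℓ
    rw [Decodes, Decodes, reaching_upTo hta]
  rw [versionAge, versionAge, decoded, decoded, h1, h2]

/-- The age is at most the number of generated versions that cannot be decoded. -/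
lemma versionAge_le_card : versionAge k j N H t ≤
    ((Finset.Icc 1 (N .source t)).filter fun ℓ => ¬ Decodes k j N H t ℓ).card := by
  have : versionAge k j N H t = (Finset.Ioc (decoded k j N H t) (N .source t)).card := by
    rw [Nat.card_Ioc, versionAge]
  rw [this]
  refine Finset.card_le_card fun ℓ hℓ => ?_
  simp only [Finset.mem_Ioc, Finset.mem_filter, Finset.mem_Icc] at hℓ ⊢
  refine ⟨⟨by omega, hℓ.2⟩, fun h => ?_⟩
  have := le_decoded h hℓ.2
  omega

/-- When all the versions have the same key holders, the age is the number of generated versions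
that cannot be decoded. -/
lemma card_le_versionAge (K : Finset (Fin m)) :
    ((Finset.Icc 1 (N .source t)).filter fun ℓ => ¬ Decodes k j N (fun _ => K) t ℓ).card ≤
      versionAge k j N (fun _ => K) t := by
  have : versionAge k j N (fun _ => K) t =
      (Finset.Ioc (decoded k j N (fun _ => K) t) (N .source t)).card := by
    rw [Nat.card_Ioc, versionAge]
  rw [this]
  refine Finset.card_le_card fun ℓ hℓ => ?_
  simp only [Finset.mem_Ioc, Finset.mem_filter, Finset.mem_Icc] at hℓ ⊢
  refine ⟨?_, hℓ.1.2⟩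
  by_contra hle
  have h0 : decoded k j N (fun _ => K) t ≠ 0 := by omega
  exact hℓ.2 (le_trans (decodes_decoded h0) (Finset.card_le_card
    (Finset.inter_subset_inter_left (reaching_anti_version (by omega)))))

section Measurability

lemma measurable_eval (c : Counter m) (t : ℝ≥0) : Measurable fun N : Path m => N c t :=
  (measurable_pi_apply t).comp (measurable_pi_apply c)

lemma measurableSet_reaches (ℓ : ℕ) (t : ℝ≥0) (i j : Fin m) :
    MeasurableSet {N : Path m | N.Reaches ℓ t i j} := by
  by_cases hij : i = j
  · simp [Reaches, hij]
  · have : {N : Path m | N.Reaches ℓ t i j} = ⋃ r : ℚ≥0, {N : Path m | (r : ℝ≥0) ≤ t ∧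
        ℓ ≤ N .source r ∧ N (.edge i j hij) r < N (.edge i j hij) t} := by
      ext N
      simp [Reaches, hij]
    rw [this]
    refine MeasurableSet.iUnion fun r => ?_
    exact (MeasurableSet.const _).inter ((measurableSet_le measurable_const
      (measurable_eval _ _)).inter (measurableSet_lt (measurable_eval _ _) (measurable_eval _ _)))

lemma measurableSet_decodes (k : ℕ) (j : Fin m) (t : ℝ≥0) (ℓ : ℕ) :
    MeasurableSet {p : Path m × (ℕ → Finset (Fin m)) | Decodes k j p.1 p.2 t ℓ} := by
  have : ∀ p : Path m × (ℕ → Finset (Fin m)), (p.2 ℓ ∩ p.1.reaching ℓ t j).card =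
      ∑ i, if i ∈ p.2 ℓ ∧ p.1.Reaches ℓ t i j then 1 else 0 := by
    intro p
    rw [← Finset.card_filter]
    congr 1
    ext i
    simp [mem_reaching]
  simp only [Decodes, this]
  refine measurableSet_le measurable_const (Finset.measurable_sum _ fun i _ => ?_)
  refine Measurable.ite ?_ measurable_const measurable_const
  have hℓ : Measurable fun p : Path m × (ℕ → Finset (Fin m)) => p.2 ℓ :=
    (measurable_pi_apply ℓ).comp measurable_snd
  exact (hℓ (measurableSet_mem_finset i)).inter
    (measurable_fst (measurableSet_reaches ℓ t i j))

lemma measurable_versionAge (k : ℕ) (j : Fin m) (t : ℝ≥0) :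
    Measurable fun p : Path m × (ℕ → Finset (Fin m)) => versionAge k j p.1 p.2 t := by
  have hs : Measurable fun p : Path m × (ℕ → Finset (Fin m)) => p.1 .source t :=
    (measurable_eval _ _).comp measurable_fst
  refine hs.sub (measurable_to_countable' fun d => ?_)
  -- The search bound in `decoded` is itself random; splitting according to its value reduces to
  -- searches with a constant bound.
  have : (fun p : Path m × (ℕ → Finset (Fin m)) => decoded k j p.1 p.2 t) ⁻¹' {d} =
      ⋃ v : ℕ, {p | p.1 .source t = v} ∩
        (fun p => Nat.findGreatest (Decodes k j p.1 p.2 t) v) ⁻¹' {d} := by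
    ext p
    simp [decoded]
  rw [this]
  exact MeasurableSet.iUnion fun v => (hs (measurableSet_singleton v)).inter
    ((measurable_findGreatest fun ℓ _ => measurableSet_decodes k j t ℓ)
      (measurableSet_singleton d))

lemma measurableSet_silent (j : Fin m) (a t : ℝ≥0) :
    MeasurableSet {N : Path m | N.Silent j a t} := by
  have : {N : Path m | N.Silent j a t} = ⋃ i, ⋃ h : i ≠ j,
      {N : Path m | N (.edge i j h) t ≤ N (.edge i j h) a} := by
    ext N
    simp [Silent]
  rw [this]
  exact MeasurableSet.iUnion fun i => MeasurableSet.iUnion fun h =>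
    measurableSet_le (measurable_eval _ _) (measurable_eval _ _)

end Measurability

/-- The path with relabelled nodes. -/
def relabel (N : Path m) (σ : Equiv.Perm (Fin m)) : Path m
  | .source => N .source
  | .edge i j h => N (.edge (σ i) (σ j) (σ.injective.ne h))

lemma reaches_relabel (σ : Equiv.Perm (Fin m)) (i : Fin m) :
    (N.relabel σ).Reaches ℓ t i j ↔ N.Reaches ℓ t (σ i) (σ j) := by
  simp only [Reaches, relabel, EmbeddingLike.apply_eq_iff_eq]
  refine or_congr Iff.rfl ⟨?_, ?_⟩
  · rintro ⟨h, r⟩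
    exact ⟨σ.injective.ne h, r⟩
  · rintro ⟨h, r⟩
    exact ⟨fun hij => h (by rw [hij]), r⟩

lemma decodes_relabel (σ : Equiv.Perm (Fin m)) :
    Decodes k j (N.relabel σ) H t ℓ ↔
      Decodes k (σ j) N (fun ℓ => (H ℓ).map σ.toEmbedding) t ℓ := by
  rw [Decodes, Decodes]
  have : (H ℓ).map σ.toEmbedding ∩ N.reaching ℓ t (σ j) =
      (H ℓ ∩ (N.relabel σ).reaching ℓ t j).map σ.toEmbedding := by
    ext i
    obtain ⟨i, rfl⟩ := σ.surjective i
    simp [mem_reaching, reaches_relabel]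
  rw [this, Finset.card_map]

lemma versionAge_relabel (σ : Equiv.Perm (Fin m)) :
    versionAge k j (N.relabel σ) H t =
      versionAge k (σ j) N (fun ℓ => (H ℓ).map σ.toEmbedding) t := by
  have h2 : Decodes k j (N.relabel σ) H t =
      Decodes k (σ j) N (fun ℓ => (H ℓ).map σ.toEmbedding) t := by
    funext ℓ
    exact propext (decodes_relabel σ)
  rw [versionAge, versionAge, decoded, decoded, h2]
  rfl

end Path

/-- Countability allows almost sure properties of the single counters to hold for all of them
simultaneously. -/
instance Counter.instCountable (m : ℕ) : Countable (Counter m) := by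
  let f : Counter m → Option (Fin m × Fin m) := fun c =>
    match c with
    | .source => none
    | .edge i j _ => some (i, j)
  refine Function.Injective.countable (f := f) ?_
  rintro (_ | ⟨i, j, h⟩) (_ | ⟨i', j', h'⟩) hf <;> simp_all [f]

/-! ### Networks as path functionals: almost sure identification, restarting, equality in law -/

namespace Network

variable {n s m : ℕ} {lamS lamE : ℝ≥0} {Ω : Type u} [MeasurableSpace Ω] {μ : Measure Ω}
  (G : Network n s m lamS lamE μ)

/-- The path of the counters. -/
def path (ω : Ω) : Path m := fun c t => G.counter c t ω

/-- The key holders of the versions. -/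
def holders (ω : Ω) : ℕ → Finset (Fin m) := fun ℓ => G.keyHolders ℓ ω

/-- The version age as a natural number, read off from the path. -/
def pathAge (k : ℕ) (j : Fin m) (t : ℝ≥0) (ω : Ω) : ℕ :=
  Path.versionAge k j (G.path ω) (G.holders ω) t

lemma measurable_path : Measurable G.path :=
  measurable_pi_lambda _ fun c => measurable_pi_lambda _ fun t => (G.poisson c).measurable t

lemma measurable_keyHolders (ℓ : ℕ) : Measurable (G.keyHolders ℓ) :=
  (Measurable.of_discrete (f := fun K : Finset (Fin m) => G.subscribers ∪ K)).comp
    (G.measurable_selected ℓ)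

lemma measurable_holders : Measurable G.holders :=
  measurable_pi_lambda _ fun ℓ => G.measurable_keyHolders ℓ

lemma measurable_pathAge (k : ℕ) (j : Fin m) (t : ℝ≥0) : Measurable (G.pathAge k j t) :=
  (Path.measurable_versionAge k j t).comp (G.measurable_path.prodMk G.measurable_holders)

/-- The almost sure properties of the paths of a network. -/
structure Regular (ω : Ω) : Prop where
  zero : ∀ c, G.counter c 0 ω = 0
  monotone : ∀ c, Monotone (G.path ω c)
  rightContinuous : ∀ c t, ContinuousWithinAt (fun v => G.counter c v ω) (Set.Ici t) t
  card_holders : ∀ ℓ, (G.holders ω ℓ).card = n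

lemma ae_selected_mem [IsProbabilityMeasure μ] (ℓ : ℕ) :
    ∀ᵐ ω ∂μ, G.selected ℓ ω ∈ Finset.powersetCard (n - s) G.subscribersᶜ := by
  have hlaw := G.law_selected ℓ
  have hne := hlaw.isProbabilityMeasure_iff.1 inferInstance
  have h : ∀ᵐ K ∂(uniformOn (↑(Finset.powersetCard (n - s) G.subscribersᶜ) :
      Set (Finset (Fin m)))), K ∈ Finset.powersetCard (n - s) G.subscribersᶜ := by
    have := ae_cond_mem (μ := Measure.count) (s := (↑(Finset.powersetCard (n - s) G.subscribersᶜ) :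
      Set (Finset (Fin m)))) (Set.toFinite _).measurableSet
    exact this
  exact (hlaw.ae_iff (Measurable.of_discrete)).2 h

lemma ae_regular [IsProbabilityMeasure μ] (hsn : s ≤ n) : ∀ᵐ ω ∂μ, G.Regular ω := by
  filter_upwards [ae_all_iff.2 fun c => (G.poisson c).zero,
    ae_all_iff.2 fun c => (G.poisson c).monotone,
    ae_all_iff.2 fun c => (G.poisson c).rightContinuous,
    ae_all_iff.2 G.ae_selected_mem] with ω h1 h2 h3 h4
  refine ⟨h1, h2, h3, fun ℓ => ?_⟩
  have h5 := Finset.mem_powersetCard.1 (h4 ℓ)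
  rw [holders, keyHolders, Finset.card_union_of_disjoint, G.card_subscribers, h5.2]
  · omega
  · exact (disjoint_compl_right (a := G.subscribers)).mono_right h5.1

variable {G}

/-- By right-continuity the counter is still unchanged shortly after the update time, so a rational
time there can replace the update time. This turns the condition into a countable union. -/
lemma Regular.activated_iff {ω : Ω} (hω : G.Regular ω) {ℓ : ℕ} {t : ℝ≥0}
    (hℓ : ℓ ≤ G.sourceVersion t ω) (c : Counter m) :
    G.counter c (G.updateTime ℓ ω) ω < G.counter c t ω ↔
      ∃ r : ℚ≥0, (r : ℝ≥0) ≤ t ∧ ℓ ≤ G.counter .source r ω ∧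
        G.counter c r ω < G.counter c t ω := by
  constructor
  · intro h
    have hlt : G.updateTime ℓ ω < t := by
      by_contra hle
      exact absurd (hω.monotone c (not_lt.1 hle)) (not_le.2 h)
    have hc := hω.rightContinuous c (G.updateTime ℓ ω)
    have hev : ∀ᶠ v in 𝓝[Set.Ici (G.updateTime ℓ ω)] (G.updateTime ℓ ω),
        G.counter c v ω = G.counter c (G.updateTime ℓ ω) ω := by
      have := hc.tendsto (IsOpen.mem_nhds (isOpen_discrete {G.counter c (G.updateTime ℓ ω) ω}) rfl)
      filter_upwards [this] with v hv using hv
    obtain ⟨v, hv, hsub⟩ := (mem_nhdsGE_iff_exists_Ico_subset' hlt).1 hev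
    -- Being strictly above the infimum `updateTime`, such an `r` already sees version `ℓ`; being
    -- below `v`, it sees no new activation.
    obtain ⟨r, hr1, hr2⟩ : ∃ r : ℚ≥0, G.updateTime ℓ ω < r ∧ (r : ℝ≥0) < min v t := by
      obtain ⟨q, hq0, hq1, hq2⟩ := (NNReal.lt_iff_exists_rat_btwn _ _).1 (lt_min hv hlt)
      refine ⟨⟨q, hq0⟩, ?_, ?_⟩
      · convert hq1 using 1
        exact NNReal.eq (by simp [Real.coe_toNNReal _ (Rat.cast_nonneg.2 hq0)]; rfl)
      · convert hq2 using 1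
        exact NNReal.eq (by simp [Real.coe_toNNReal _ (Rat.cast_nonneg.2 hq0)]; rfl)
    refine ⟨r, (hr2.trans_le (min_le_right _ _)).le, ?_, ?_⟩
    · obtain ⟨x, hx, hxr⟩ := exists_lt_of_csInf_lt (s := {t | ℓ ≤ G.sourceVersion t ω}) ⟨t, hℓ⟩ hr1
      exact le_trans hx (hω.monotone .source hxr.le)
    · have : G.counter c r ω = G.counter c (G.updateTime ℓ ω) ω :=
        hsub ⟨hr1.le, hr2.trans_le (min_le_left _ _)⟩
      rwa [this]
  · rintro ⟨r, -, h2, h3⟩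
    have : G.updateTime ℓ ω ≤ r := csInf_le (OrderBot.bddBelow _) h2
    exact lt_of_le_of_lt (hω.monotone c this) h3

lemma Regular.canDecode_iff {ω : Ω} (hω : G.Regular ω) {k : ℕ} {j : Fin m} {ℓ : ℕ} {t : ℝ≥0} :
    G.CanDecode k j ℓ t ω ↔ ℓ ≤ G.path ω .source t ∧
      Path.Decodes k j (G.path ω) (G.holders ω) t ℓ := by
  refine and_congr_right fun hℓ => ?_
  have : G.keys j ℓ t ω = ↑(G.holders ω ℓ ∩ (G.path ω).reaching ℓ t j) := by
    ext i
    simp only [keys, Set.mem_ofPred_eq, Finset.coe_inter, Set.mem_inter_iff, Finset.mem_coe,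
      Path.mem_reaching]
    refine and_congr Iff.rfl (or_congr Iff.rfl (exists_congr fun h => ?_))
    exact hω.activated_iff hℓ _
  rw [this, Set.ncard_coe_finset, Path.Decodes]

lemma Regular.decodedVersion_eq {ω : Ω} (hω : G.Regular ω) {k : ℕ} {j : Fin m} {t : ℝ≥0} :
    G.decodedVersion k j t ω = Path.decoded k j (G.path ω) (G.holders ω) t := by
  simp only [decodedVersion, hω.canDecode_iff]
  refine le_antisymm ?_ ?_
  · refine csSup_le' ?_
    rintro ℓ ⟨h1, h2⟩
    exact Path.le_decoded h2 h1
  · by_cases h0 : Path.decoded k j (G.path ω) (G.holders ω) t = 0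
    · simp [h0]
    · exact le_csSup ⟨G.path ω .source t, fun ℓ h => h.1⟩
        ⟨Path.decoded_le, Path.decodes_decoded h0⟩

lemma Regular.age_eq {ω : Ω} (hω : G.Regular ω) (k : ℕ) (j : Fin m) (t : ℝ≥0) :
    G.age k j t ω = (G.path ω .source t : ℝ) - Path.decoded k j (G.path ω) (G.holders ω) t := by
  rw [age, hω.decodedVersion_eq]
  rfl

variable (G)

lemma iIndepFun_shifted_counters (a : ℝ≥0) :
    iIndepFun (fun c ω t => G.counter c (a + t) ω - G.counter c a ω) μ :=
  G.indep_counters.comp (fun _ (f : ℝ≥0 → ℕ) t => f (a + t) - f a) fun _ =>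
    measurable_pi_lambda _ fun _ => (measurable_pi_apply _).sub (measurable_pi_apply _)

/-- The network restarted at time `a`, the versions being renumbered from version `c` on. -/
def shift (a : ℝ≥0) (c : ℕ) : Network n s m lamS lamE μ where
  subscribers := G.subscribers
  card_subscribers := G.card_subscribers
  counter e t ω := G.counter e (a + t) ω - G.counter e a ω
  selected ℓ := G.selected (c + ℓ)
  poisson e := (G.poisson e).shift a
  measurable_selected _ := G.measurable_selected _
  law_selected _ := G.law_selected _
  indep_counters := G.iIndepFun_shifted_counters a
  indep_selected := G.indep_selected.precomp (add_right_injective c)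
  indep_counters_selected :=
    G.indep_counters_selected.comp
      (φ := fun (N : Path m) => N.shift a)
      (ψ := fun (H : ℕ → Finset (Fin m)) ℓ => H (c + ℓ))
      (measurable_pi_lambda _ fun _ => measurable_pi_lambda _ fun _ =>
        (Path.measurable_eval _ _).sub (Path.measurable_eval _ _))
      (measurable_pi_lambda _ fun _ => measurable_pi_apply _)

lemma path_shift (a : ℝ≥0) (c : ℕ) (ω : Ω) : (G.shift a c).path ω = (G.path ω).shift a := rfl

lemma holders_shift (a : ℝ≥0) (c : ℕ) (ω : Ω) :
    (G.shift a c).holders ω = fun ℓ => G.holders ω (c + ℓ) := rfl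

variable {G}

/-- The law of the counters of a network. -/
lemma map_path_eq [IsProbabilityMeasure μ] {Ω' : Type u} [MeasurableSpace Ω'] {μ' : Measure Ω'}
    [IsProbabilityMeasure μ'] {N : Counter m → ℝ≥0 → Ω → ℕ} {N' : Counter m → ℝ≥0 → Ω' → ℕ}
    (hN : ∀ c, IsPoissonCounter (N c) (c.rate lamS lamE) μ)
    (hN' : ∀ c, IsPoissonCounter (N' c) (c.rate lamS lamE) μ')
    (hi : iIndepFun (fun c ω t => N c t ω) μ) (hi' : iIndepFun (fun c ω t => N' c t ω) μ') :
    μ.map (fun ω c t => N c t ω) = μ'.map (fun ω c t => N' c t ω) := by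
  rw [hi.map_fun_eq_infinitePi_map fun c => (hN c).measurable_path,
    hi'.map_fun_eq_infinitePi_map fun c => (hN' c).measurable_path]
  congr 1
  funext c
  exact (hN c).map_path_eq (hN' c)

/-- Networks with the same parameters and the same subscribers have the same law. -/
theorem map_path_selected_eq [IsProbabilityMeasure μ] {Ω' : Type u}
    [MeasurableSpace Ω'] {μ' : Measure Ω'} [IsProbabilityMeasure μ']
    (G : Network n s m lamS lamE μ) (G' : Network n s m lamS lamE μ')
    (hs : G.subscribers = G'.subscribers) :
    μ.map (fun ω => (G.path ω, fun ℓ => G.selected ℓ ω)) =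
      μ'.map (fun ω => (G'.path ω, fun ℓ => G'.selected ℓ ω)) := by
  have hm := measurable_pi_lambda _ G.measurable_selected
  have hm' := measurable_pi_lambda _ G'.measurable_selected
  rw [(indepFun_iff_map_prod_eq_prod_map_map G.measurable_path.aemeasurable
      hm.aemeasurable).1 G.indep_counters_selected,
    (indepFun_iff_map_prod_eq_prod_map_map G'.measurable_path.aemeasurable
      hm'.aemeasurable).1 G'.indep_counters_selected]
  congr 1
  · exact map_path_eq G.poisson G'.poisson G.indep_counters G'.indep_counters
  · rw [G.indep_selected.map_fun_eq_infinitePi_map G.measurable_selected,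
      G'.indep_selected.map_fun_eq_infinitePi_map G'.measurable_selected]
    congr 1
    funext ℓ
    rw [(G.law_selected ℓ).map_eq, (G'.law_selected ℓ).map_eq, hs]

/-- The mean age at time `t`. -/
def meanAge (G : Network n s m lamS lamE μ) (k : ℕ) (j : Fin m) (t : ℝ≥0) : ℝ≥0∞ :=
  ∫⁻ ω, (G.pathAge k j t ω : ℝ≥0∞) ∂μ

lemma meanAge_congr [IsProbabilityMeasure μ] {Ω' : Type u}
    [MeasurableSpace Ω'] {μ' : Measure Ω'} [IsProbabilityMeasure μ']
    (G : Network n s m lamS lamE μ) (G' : Network n s m lamS lamE μ')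
    (hs : G.subscribers = G'.subscribers) (k : ℕ) (j : Fin m) (t : ℝ≥0) :
    G.meanAge k j t = G'.meanAge k j t := by
  let f : Path m × (ℕ → Finset (Fin m)) → ℝ≥0∞ := fun p =>
    (Path.versionAge k j p.1 (fun ℓ => G.subscribers ∪ p.2 ℓ) t : ℝ≥0∞)
  have hf : Measurable f := by
    have h1 : Measurable fun p : Path m × (ℕ → Finset (Fin m)) =>
        ((p.1, fun ℓ => G.subscribers ∪ p.2 ℓ) : Path m × (ℕ → Finset (Fin m))) := by
      refine measurable_fst.prodMk (measurable_pi_lambda _ fun ℓ => ?_)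
      exact (Measurable.of_discrete (f := fun K : Finset (Fin m) => G.subscribers ∪ K)).comp
        ((measurable_pi_apply ℓ).comp measurable_snd)
    exact (Measurable.of_discrete (f := fun x : ℕ => (x : ℝ≥0∞))).comp
      ((Path.measurable_versionAge k j t).comp h1)
  have e1 : G.meanAge k j t = ∫⁻ p, f p ∂μ.map (fun ω => (G.path ω, fun ℓ => G.selected ℓ ω)) := by
    rw [lintegral_map hf (G.measurable_path.prodMk (measurable_pi_lambda _ G.measurable_selected))]
    rfl
  have e2 : G'.meanAge k j t =
      ∫⁻ p, f p ∂μ'.map (fun ω => (G'.path ω, fun ℓ => G'.selected ℓ ω)) := by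
    rw [lintegral_map hf
      (G'.measurable_path.prodMk (measurable_pi_lambda _ G'.measurable_selected))]
    simp only [f, hs]
    rfl
  rw [e1, e2, map_path_selected_eq G G' hs]

end Network

/-! ### Rearranging independent families -/

section Independence

variable {Ω : Type*} [MeasurableSpace Ω] {μ : Measure Ω}

lemma iIndepFun_bool {α : Type*} [MeasurableSpace α] [IsProbabilityMeasure μ] {X : Bool → Ω → α}
    (h : IndepFun (X false) (X true) μ) : iIndepFun X μ := by
  rw [iIndepFun_iff_measure_inter_preimage_eq_mul]
  intro S sets hsets
  by_cases h0 : false ∈ S <;> by_cases h1 : true ∈ S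
  · have : S = {false, true} := by ext b; cases b <;> simp [h0, h1]
    subst this
    rw [Finset.set_biInter_insert, Finset.set_biInter_singleton, Finset.prod_pair (by simp)]
    exact h.measure_inter_preimage_eq_mul _ _ (hsets _ h0) (hsets _ h1)
  · have : S = {false} := by ext b; cases b <;> simp [h0, h1]
    subst this
    simp
  · have : S = {true} := by ext b; cases b <;> simp [h0, h1]
    subst this
    simp
  · have : S = ∅ := by ext b; cases b <;> simp [h0, h1]
    subst this
    simp

lemma iIndepFun.indepFun_restrict {ι α : Type*} [MeasurableSpace α] {X : ι → Ω → α}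
    (h : iIndepFun X μ) (hX : ∀ i, Measurable (X i)) {S T : Set ι} (hST : Disjoint S T) :
    IndepFun (fun ω (i : S) => X i ω) (fun ω (i : T) => X i ω) μ := by
  have key : ∀ S : Set ι, MeasurableSpace.comap (fun ω (i : S) => X i ω) inferInstance ≤
      ⨆ i ∈ S, MeasurableSpace.comap (X i) inferInstance := by
    intro S
    rw [← measurable_iff_comap_le, @measurable_pi_iff]
    intro i
    exact measurable_iff_comap_le.2
      (le_iSup₂ (f := fun i (_ : i ∈ S) => MeasurableSpace.comap (X i) inferInstance) i.1 i.2)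
  exact indep_of_indep_of_le_left (indep_of_indep_of_le_right
    (indep_iSup_of_disjoint (fun i => (hX i).comap_le) h hST) (key T)) (key S)

/-- Independence across pairs and within each pair makes the family over `ι × Bool` independent; it
is then split according to the Boolean. -/
lemma iIndepFun.indepFun_pi_pi {ι α : Type*} [MeasurableSpace α] [IsProbabilityMeasure μ]
    {Y Z : ι → Ω → α} (hY : ∀ i, Measurable (Y i)) (hZ : ∀ i, Measurable (Z i))
    (h : iIndepFun (fun i ω => (Y i ω, Z i ω)) μ) (hi : ∀ i, IndepFun (Y i) (Z i) μ) :
    IndepFun (fun ω i => Y i ω) (fun ω i => Z i ω) μ := by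
  let X : ι → Bool → Ω → α := fun i b => if b then Z i else Y i
  have hX : ∀ i b, Measurable (X i b) := by
    intro i b
    cases b
    · exact hY i
    · exact hZ i
  have h1 : iIndepFun (fun i ω b => X i b ω) μ := by
    have := h.comp (fun _ (p : α × α) (b : Bool) => if b then p.2 else p.1) fun i =>
      measurable_pi_lambda _ fun b => by
        cases b
        · exact measurable_fst
        · exact measurable_snd
    convert this using 3
    rename_i i ω
    funext b
    cases b <;> rfl
  have h2 := iIndepFun_uncurry' hX h1 fun i => iIndepFun_bool (hi i)
  have h3 := iIndepFun.indepFun_restrict h2 (fun p => hX p.1 p.2)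
    (S := {p | p.2 = false}) (T := {p | p.2 = true})
    (Set.disjoint_left.2 fun p hp hp' => by simp_all)
  exact h3.comp
    (φ := fun f i => f ⟨(i, false), rfl⟩) (ψ := fun f i => f ⟨(i, true), rfl⟩)
    (measurable_pi_lambda _ fun i => measurable_pi_apply _)
    (measurable_pi_lambda _ fun i => measurable_pi_apply _)

lemma measurePreserving_prod_prod_comm {α β γ δ : Type*} [MeasurableSpace α] [MeasurableSpace β]
    [MeasurableSpace γ] [MeasurableSpace δ] (a : Measure α) (b : Measure β) (c : Measure γ)
    (d : Measure δ) [SFinite a] [SFinite b] [SFinite c] [SFinite d] :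
    MeasurePreserving (fun p : (α × β) × (γ × δ) => ((p.1.1, p.2.1), (p.1.2, p.2.2)))
      ((a.prod b).prod (c.prod d)) ((a.prod c).prod (b.prod d)) := by
  have h1 := measurePreserving_prodAssoc a b (c.prod d)
  have h2 := ((measurePreserving_prodAssoc b c d).symm MeasurableEquiv.prodAssoc)
  have h3 := (Measure.measurePreserving_swap (μ := b) (ν := c)).prod (MeasurePreserving.id d)
  have h4 := measurePreserving_prodAssoc c b d
  have h5 := (MeasurePreserving.id a).prod (h4.comp (h3.comp h2))
  have h6 := (measurePreserving_prodAssoc a c (b.prod d)).symm MeasurableEquiv.prodAssoc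
  exact h6.comp (h5.comp h1)

/-- The joint law is a product of four factors, and exchanging the middle two regroups them. It is
applied with the counters and the selections, each divided into past and future. -/
lemma IndepFun.prodMk_prodMk {α β γ δ : Type*} [MeasurableSpace α] [MeasurableSpace β]
    [MeasurableSpace γ] [MeasurableSpace δ] [IsProbabilityMeasure μ] {X : Ω → α} {X' : Ω → β}
    {Y : Ω → γ} {Y' : Ω → δ} (hX : Measurable X) (hX' : Measurable X') (hY : Measurable Y)
    (hY' : Measurable Y') (h : IndepFun (fun ω => (X ω, X' ω)) (fun ω => (Y ω, Y' ω)) μ)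
    (hXX : IndepFun X X' μ) (hYY : IndepFun Y Y' μ) :
    IndepFun (fun ω => (X ω, Y ω)) (fun ω => (X' ω, Y' ω)) μ := by
  have e1 : IndepFun X Y μ := h.comp measurable_fst measurable_fst
  have e2 : IndepFun X' Y' μ := h.comp measurable_snd measurable_snd
  rw [indepFun_iff_map_prod_eq_prod_map_map (by fun_prop) (by fun_prop)] at e1 e2 hXX hYY h ⊢
  rw [e1, e2, ← (measurePreserving_prod_prod_comm _ _ _ _).map_eq, ← hXX, ← hYY, ← h,
    Measure.map_map (by fun_prop) (by fun_prop)]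
  rfl

end Independence

/-! ### Independence of past and future of a network -/

namespace Network

variable {n s m : ℕ} {lamS lamE : ℝ≥0} {Ω : Type u} [MeasurableSpace Ω] {μ : Measure Ω}
  (G : Network n s m lamS lamE μ)

/-- The counters up to time `a` and the selections up to version `c`. -/
def past (a : ℝ≥0) (c : ℕ) (ω : Ω) : Path m × (Set.Iic c → Finset (Fin m)) :=
  ((G.path ω).upTo a, fun ℓ => G.selected ℓ ω)

/-- The counters after time `a` and the selections after version `c`. -/
def future (a : ℝ≥0) (c : ℕ) (ω : Ω) : Path m × (Set.Ioi c → Finset (Fin m)) :=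
  ((G.path ω).shift a, fun ℓ => G.selected ℓ ω)

lemma measurable_upTo (a : ℝ≥0) : Measurable fun N : Path m => N.upTo a :=
  measurable_pi_lambda _ fun _ => measurable_pi_lambda _ fun _ => Path.measurable_eval _ _

lemma measurable_shift (a : ℝ≥0) : Measurable fun N : Path m => N.shift a :=
  measurable_pi_lambda _ fun _ => measurable_pi_lambda _ fun _ =>
    (Path.measurable_eval _ _).sub (Path.measurable_eval _ _)

lemma measurable_past (a : ℝ≥0) (c : ℕ) : Measurable (G.past a c) :=
  ((measurable_upTo a).comp G.measurable_path).prodMk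
    (measurable_pi_lambda _ fun _ => G.measurable_selected _)

lemma measurable_future (a : ℝ≥0) (c : ℕ) : Measurable (G.future a c) :=
  ((measurable_shift a).comp G.measurable_path).prodMk
    (measurable_pi_lambda _ fun _ => G.measurable_selected _)

lemma indepFun_upTo_shift [IsProbabilityMeasure μ] (a : ℝ≥0) :
    IndepFun (fun ω => (G.path ω).upTo a) (fun ω => (G.path ω).shift a) μ := by
  refine iIndepFun.indepFun_pi_pi
    (Y := fun c ω s => G.counter c (min s a) ω)
    (Z := fun c ω s => G.counter c (a + s) ω - G.counter c a ω) ?_ ?_ ?_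
    (fun c => (G.poisson c).indepFun_past_future a)
  · exact fun c => measurable_pi_lambda _ fun s => (G.poisson c).measurable _
  · exact fun c => measurable_pi_lambda _ fun s => (G.poisson c).measurable_increment _ _
  · exact G.indep_counters.comp
      (fun _ (f : ℝ≥0 → ℕ) => ((fun s => f (min s a), fun s => f (a + s) - f a) :
        (ℝ≥0 → ℕ) × (ℝ≥0 → ℕ)))
      (fun c => (measurable_pi_lambda _ fun s => measurable_pi_apply _).prodMk
        (measurable_pi_lambda _ fun s => (measurable_pi_apply _).sub (measurable_pi_apply _)))

theorem indepFun_past_future [IsProbabilityMeasure μ] (a : ℝ≥0) (c : ℕ) :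
    IndepFun (G.past a c) (G.future a c) μ := by
  have hd : Disjoint (Set.Iic c) (Set.Ioi c) := Set.Iic_disjoint_Ioi le_rfl
  refine IndepFun.prodMk_prodMk ((measurable_upTo a).comp G.measurable_path)
    ((measurable_shift a).comp G.measurable_path)
    (measurable_pi_lambda _ fun _ => G.measurable_selected _)
    (measurable_pi_lambda _ fun _ => G.measurable_selected _) ?_ (G.indepFun_upTo_shift a)
    (iIndepFun.indepFun_restrict G.indep_selected G.measurable_selected hd)
  exact G.indep_counters_selected.comp
    (φ := fun N : Path m => (N.upTo a, N.shift a))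
    (ψ := fun H : ℕ → Finset (Fin m) =>
      ((fun ℓ => H ℓ, fun ℓ => H ℓ) :
        (Set.Iic c → Finset (Fin m)) × (Set.Ioi c → Finset (Fin m))))
    ((measurable_upTo a).prodMk (measurable_shift a))
    ((measurable_pi_lambda _ fun _ => measurable_pi_apply _).prodMk
      (measurable_pi_lambda _ fun _ => measurable_pi_apply _))

/-- Independence of past and future at a fixed time, the past and the future being known on each
event `N₀(a) = c` as functions of the selections up to version `c` and after version `c`. -/
theorem lintegral_mul_past_future [IsProbabilityMeasure μ] (a : ℝ≥0) {X Z : Ω → ℝ≥0∞}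
    (hX : Measurable X) (hZ : Measurable Z)
    {f : (c : ℕ) → Path m × (Set.Iic c → Finset (Fin m)) → ℝ≥0∞}
    {g : (c : ℕ) → Path m × (Set.Ioi c → Finset (Fin m)) → ℝ≥0∞}
    (hf : ∀ c, Measurable (f c)) (hg : ∀ c, Measurable (g c))
    (hXf : ∀ᵐ ω ∂μ, X ω = f (G.counter .source a ω) (G.past a (G.counter .source a ω) ω))
    (hZg : ∀ᵐ ω ∂μ, Z ω = g (G.counter .source a ω) (G.future a (G.counter .source a ω) ω))
    {z : ℝ≥0∞} (hz : ∀ c, ∫⁻ ω, g c (G.future a c ω) ∂μ = z) :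
    ∫⁻ ω, X ω * Z ω ∂μ = (∫⁻ ω, X ω ∂μ) * z := by
  have hN : Measurable (G.counter .source a) := (G.poisson .source).measurable a
  have hsplit : ∀ Y : Ω → ℝ≥0∞, Measurable Y →
      ∫⁻ ω, Y ω ∂μ = ∑' c, ∫⁻ ω, (if G.counter .source a ω = c then Y ω else 0) ∂μ := by
    intro Y hY
    have hm : ∀ c, Measurable fun ω => if G.counter .source a ω = c then Y ω else 0 := fun c =>
      Measurable.ite (hN (measurableSet_singleton c)) hY measurable_const
    rw [← lintegral_tsum fun c => (hm c).aemeasurable]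
    refine lintegral_congr fun ω => ?_
    rw [tsum_eq_single (G.counter .source a ω) (fun c hc => if_neg hc.symm), if_pos rfl]
  rw [hsplit (fun ω => X ω * Z ω) (hX.mul hZ), hsplit _ hX, ← ENNReal.tsum_mul_right]
  refine tsum_congr fun c => ?_
  -- The selections are cut at the random index `N₀(a)`, so independence is available only for each
  -- fixed value `c`. The event `N₀(a) = c` is a function of the stopped path and joins the past
  -- factor.
  let F : Path m × (Set.Iic c → Finset (Fin m)) → ℝ≥0∞ := fun p =>
    if p.1 .source a = c then f c p else 0
  have hF : Measurable F := Measurable.ite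
    (((Path.measurable_eval .source a).comp measurable_fst) (measurableSet_singleton c))
    (hf c) measurable_const
  have hFp : ∀ ω, F (G.past a c ω) =
      if G.counter .source a ω = c then f c (G.past a c ω) else 0 := by
    intro ω
    simp [F, past, Path.upTo, path]
  have e1 : ∫⁻ ω, (if G.counter .source a ω = c then X ω * Z ω else 0) ∂μ =
      ∫⁻ ω, F (G.past a c ω) * g c (G.future a c ω) ∂μ := by
    refine lintegral_congr_ae ?_
    filter_upwards [hXf, hZg] with ω h1 h2
    rw [hFp]
    split_ifs with hc
    · subst hc
      rw [h1, h2]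
    · simp
  have e2 : ∫⁻ ω, (if G.counter .source a ω = c then X ω else 0) ∂μ =
      ∫⁻ ω, F (G.past a c ω) ∂μ := by
    refine lintegral_congr_ae ?_
    filter_upwards [hXf] with ω h1
    rw [hFp]
    split_ifs with hc
    · subst hc
      exact h1
    · rfl
  rw [e1, e2, ← hz c]
  exact lintegral_mul_eq_lintegral_mul_lintegral_of_indepFun (hF.comp (G.measurable_past a c))
    ((hg c).comp (G.measurable_future a c)) ((G.indepFun_past_future a c).comp hF (hg c))

end Network

/-! ### A strong law for variables with summable correlations -/

section StrongLaw

variable {Ω : Type*} [MeasurableSpace Ω] {μ : Measure Ω}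

/-- Along the squares, the centered averages tend to zero if the variances of the sums grow at
most linearly. -/
lemma ae_tendsto_centered_squares [IsProbabilityMeasure μ] {S : ℕ → Ω → ℝ}
    (hS : ∀ n, MemLp (S n) 2 μ) {C : ℝ} (hC : ∀ n, variance (S n) μ ≤ C * n) :
    ∀ᵐ ω ∂μ, Tendsto (fun p : ℕ => (S ((p + 1) ^ 2) ω - ∫ x, S ((p + 1) ^ 2) x ∂μ) /
      ((p + 1) ^ 2 : ℕ)) atTop (𝓝 0) := by
  let Y : ℕ → Ω → ℝ := fun p ω =>
    ((S ((p + 1) ^ 2) ω - ∫ x, S ((p + 1) ^ 2) x ∂μ) / ((p + 1) ^ 2 : ℕ)) ^ 2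
  have hYm : ∀ p, AEMeasurable (fun ω => ENNReal.ofReal (Y p ω)) μ := fun p =>
    ((((hS _).aestronglyMeasurable.aemeasurable.sub_const _).div_const _).pow_const 2).ennreal_ofReal
  have hYi : ∀ p, ∫⁻ ω, ENNReal.ofReal (Y p ω) ∂μ ≤
      ENNReal.ofReal (C * (1 / ((p : ℝ) + 1) ^ 2)) := by
    intro p
    have hsq : Integrable (fun ω => (S ((p + 1) ^ 2) ω - ∫ x, S ((p + 1) ^ 2) x ∂μ) ^ 2) μ :=
      ((hS _).sub (memLp_const _)).integrable_sq
    have hi : Integrable (Y p) μ := by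
      simp only [Y, div_pow]
      exact hsq.div_const _
    rw [← ofReal_integral_eq_lintegral_ofReal hi (ae_of_all _ fun ω => sq_nonneg _)]
    refine ENNReal.ofReal_le_ofReal ?_
    have hv := hC ((p + 1) ^ 2)
    rw [variance_eq_integral (hS _).aestronglyMeasurable.aemeasurable] at hv
    simp only [Y, div_pow]
    rw [integral_div]
    have hp : (0 : ℝ) < ((p : ℝ) + 1) ^ 2 := by positivity
    push_cast at hv ⊢
    rw [div_le_iff₀ (by positivity)]
    calc _ ≤ C * ((p : ℝ) + 1) ^ 2 := hv
      _ = C * (1 / ((p : ℝ) + 1) ^ 2) * (((p : ℝ) + 1) ^ 2) ^ 2 := by field_simp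
  have hsum : Summable fun p : ℕ => C * (1 / ((p : ℝ) + 1) ^ 2) := by
    refine Summable.mul_left _ ?_
    have := (summable_nat_add_iff 1).2 (Real.summable_one_div_nat_pow.2 (by norm_num : 1 < 2))
    simpa using this
  -- The mean of `Y p` is at most `C / (p + 1) ^ 2`, so the series of the `Y p` converges almost
  -- surely and its terms tend to zero.
  have hfin : ∫⁻ ω, ∑' p, ENNReal.ofReal (Y p ω) ∂μ ≠ ∞ := by
    rw [lintegral_tsum hYm]
    refine ne_top_of_le_ne_top ?_ (ENNReal.tsum_le_tsum hYi)
    exact hsum.tsum_ofReal_ne_top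
  filter_upwards [ae_lt_top' (AEMeasurable.tsum hYm) hfin] with ω hω
  have h1 := ENNReal.tendsto_atTop_zero_of_tsum_ne_top hω.ne
  have h2 : Tendsto (fun p => Y p ω) atTop (𝓝 0) := by
    have := (ENNReal.tendsto_toReal ENNReal.zero_ne_top).comp h1
    simpa [Function.comp_def, ENNReal.toReal_ofReal (show 0 ≤ Y _ ω from sq_nonneg _)] using this
  have h3 := h2.sqrt
  rw [Real.sqrt_zero] at h3
  simp only [Y, Real.sqrt_sq_eq_abs] at h3
  exact (tendsto_zero_iff_abs_tendsto_zero _).2 h3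

/-- A strong law of large numbers for nonnegative random variables, when the means converge and
the variances of the sums grow at most linearly. -/
theorem ae_tendsto_average [IsProbabilityMeasure μ] {X : ℕ → Ω → ℝ} (h0 : ∀ i ω, 0 ≤ X i ω)
    (hX : ∀ i, MemLp (X i) 2 μ) {C : ℝ}
    (hC : ∀ n : ℕ, variance (∑ i ∈ Finset.range n, X i) μ ≤ C * n) {c : ℝ}
    (hc : Tendsto (fun i => ∫ ω, X i ω ∂μ) atTop (𝓝 c)) :
    ∀ᵐ ω ∂μ, Tendsto (fun n : ℕ => (∑ i ∈ Finset.range n, X i ω) / n) atTop (𝓝 c) := by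
  have hS : ∀ n, MemLp (∑ i ∈ Finset.range n, X i) 2 μ := fun n =>
    memLp_finsetSum' _ fun i _ => hX i
  have hmean : Tendsto (fun n : ℕ => (∫ ω, (∑ i ∈ Finset.range n, X i) ω ∂μ) / n) atTop (𝓝 c) := by
    have := hc.cesaro
    refine this.congr fun n => ?_
    simp only [Finset.sum_apply]
    rw [integral_finsetSum _ fun i _ => (hX i).integrable one_le_two]
    ring
  have hsq : Tendsto (fun p : ℕ => (p + 1) ^ 2) atTop atTop :=
    (tendsto_pow_atTop two_ne_zero).comp (tendsto_add_atTop_nat 1)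
  filter_upwards [ae_tendsto_centered_squares hS hC] with ω hω
  have h1 := hω.add (hmean.comp hsq)
  rw [zero_add] at h1
  -- Partial sums of nonnegative terms are monotone and ratios of consecutive squares tend to `1`,
  -- so convergence along squares extends to all indices.
  refine tendsto_div_of_monotone_of_exists_subseq_tendsto_div _ c ?_ fun a ha =>
    ⟨fun p => (p + 1) ^ 2, ?_, hsq, ?_⟩
  · intro p q hpq
    exact Finset.sum_le_sum_of_subset_of_nonneg (Finset.range_mono hpq) fun i _ _ => h0 i ω
  · have hlim : Tendsto (fun p : ℕ => (1 + 1 / ((p : ℝ) + 1)) ^ 2) atTop (𝓝 1) := by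
      have := (tendsto_const_nhds (x := (1 : ℝ))).add
        (tendsto_one_div_add_atTop_nhds_zero_nat (𝕜 := ℝ))
      simpa using this.pow 2
    filter_upwards [hlim.eventually_le_const ha] with p hp
    push_cast
    have hpos : (0 : ℝ) < (p : ℝ) + 1 := by positivity
    calc ((p : ℝ) + 1 + 1) ^ 2 = (1 + 1 / ((p : ℝ) + 1)) ^ 2 * ((p : ℝ) + 1) ^ 2 := by
          field_simp
      _ ≤ a * ((p : ℝ) + 1) ^ 2 := by gcongr
  · refine h1.congr fun p => ?_
    simp only [Function.comp, Finset.sum_apply]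
    ring

/-- Exponentially decaying bounds for the covariances give a linear bound for the variances of
the sums. -/
lemma variance_sum_le_of_covariance_le [IsProbabilityMeasure μ] {X : ℕ → Ω → ℝ}
    (hX : ∀ i, MemLp (X i) 2 μ) {K ρ : ℝ} (hK : 0 ≤ K) (hρ0 : 0 ≤ ρ) (hρ : ρ < 1)
    (hcov : ∀ i d, covariance (X i) (X (i + d)) μ ≤ K * ρ ^ d) (n : ℕ) :
    variance (∑ i ∈ Finset.range n, X i) μ ≤ 2 * K * (1 - ρ)⁻¹ * n := by
  have hgeo : ∀ N : ℕ, ∑ d ∈ Finset.range N, ρ ^ d ≤ (1 - ρ)⁻¹ := fun N => by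
    rw [← tsum_geometric_of_lt_one hρ0 hρ]
    exact (summable_geometric_of_lt_one hρ0 hρ).sum_le_tsum _ fun _ _ => by positivity
  induction n with
  | zero => simp [variance_zero]
  | succ n ih =>
    have hSn : MemLp (∑ i ∈ Finset.range n, X i) 2 μ := memLp_finsetSum' _ fun i _ => hX i
    rw [Finset.sum_range_succ, variance_add hSn (hX n), covariance_sum_left' (fun i _ => hX i) (hX n)]
    have h1 : ∑ i ∈ Finset.range n, covariance (X i) (X n) μ ≤
        ∑ i ∈ Finset.range n, K * ρ ^ (i + 1) := by
      rw [← Finset.sum_range_reflect (fun i => K * ρ ^ (i + 1))]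
      refine Finset.sum_le_sum fun i hi => ?_
      have hi := Finset.mem_range.1 hi
      have := hcov i (n - i)
      rw [Nat.add_sub_cancel' hi.le] at this
      rwa [show n - 1 - i + 1 = n - i by omega]
    have h2 : variance (X n) μ ≤ K * ρ ^ 0 := by
      have := hcov n 0
      rwa [add_zero, covariance_self (hX n).aestronglyMeasurable.aemeasurable] at this
    have h3 : K * ρ ^ 0 + ∑ i ∈ Finset.range n, K * ρ ^ (i + 1) ≤ K * (1 - ρ)⁻¹ := by
      rw [add_comm, ← Finset.sum_range_succ' (fun i => K * ρ ^ i), ← Finset.mul_sum]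
      exact mul_le_mul_of_nonneg_left (hgeo _) hK
    have h4 : 0 ≤ ∑ i ∈ Finset.range n, K * ρ ^ (i + 1) :=
      Finset.sum_nonneg fun i _ => by positivity
    have h5 : 0 ≤ K * ρ ^ 0 := by positivity
    push_cast
    linarith

end StrongLaw

/-! ### Moments and void probabilities of Poisson increments -/

section PoissonMoments

lemma lintegral_sq_poissonMeasure_ne_top (r : ℝ≥0) :
    ∫⁻ x, (x : ℝ≥0∞) ^ 2 ∂poissonMeasure r ≠ ∞ := by
  have hint : Integrable (fun x : ℕ => (x : ℝ) ^ 2) (poissonMeasure r) := by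
    rw [integrable_poissonMeasure_iff]
    have h := (Real.summable_pow_div_factorial (4 * (r : ℝ))).mul_left (Real.exp (-r))
    refine h.of_nonneg_of_le (fun n => by positivity) fun n => ?_
    -- This crude bound dominates the second moment by an exponential series at `4 * r`.
    have h2 : ((n : ℝ)) ^ 2 ≤ 4 ^ n := by
      have : (n : ℝ) ≤ 2 ^ n := by exact_mod_cast Nat.lt_two_pow_self.le
      calc ((n : ℝ)) ^ 2 ≤ (2 ^ n) ^ 2 := by gcongr
        _ = 4 ^ n := by rw [← pow_mul, mul_comm, pow_mul]; norm_num
    rw [Real.norm_of_nonneg (by positivity), mul_pow, ← mul_div_assoc]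
    rw [div_mul_eq_mul_div]
    gcongr ?_ / _
    calc Real.exp (-r) * (r : ℝ) ^ n * (n : ℝ) ^ 2 ≤ Real.exp (-r) * (r : ℝ) ^ n * 4 ^ n := by
          gcongr
      _ = Real.exp (-r) * (4 ^ n * (r : ℝ) ^ n) := by ring
  have := hint.lintegral_lt_top
  refine (lt_of_le_of_lt (lintegral_mono fun x => ?_) this).ne
  rw [ENNReal.ofReal_pow (by positivity), ENNReal.ofReal_natCast]

variable {Ω : Type*} [MeasurableSpace Ω] {μ : Measure Ω} {N : ℝ≥0 → Ω → ℕ} {r : ℝ≥0}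

lemma IsPoissonCounter.lintegral_increment_sq (h : IsPoissonCounter N r μ) (a d : ℝ≥0) :
    ∫⁻ ω, ((N (a + d) ω - N a ω : ℕ) : ℝ≥0∞) ^ 2 ∂μ =
      ∫⁻ x, (x : ℝ≥0∞) ^ 2 ∂poissonMeasure (r * d) := by
  have := (h.law_increment a (a + d) le_self_add).lintegral_comp (f := fun x : ℕ => (x : ℝ≥0∞) ^ 2)
    Measurable.of_discrete.aemeasurable
  rwa [add_tsub_cancel_left] at this

lemma IsPoissonCounter.measure_increment_eq_zero (h : IsPoissonCounter N r μ) (a d : ℝ≥0) :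
    μ {ω | N (a + d) ω ≤ N a ω} = ENNReal.ofReal (Real.exp (-(r * d))) := by
  have := (h.law_increment a (a + d) le_self_add).measure_eq (p := fun x => x = 0)
    (measurableSet_singleton 0)
  rw [add_tsub_cancel_left] at this
  have e : {ω | N (a + d) ω ≤ N a ω} = {ω | N (a + d) ω - N a ω = 0} := by
    ext ω
    simp [Nat.sub_eq_zero_iff_le]
  rw [e, this]
  simp [poissonMeasure_singleton]

end PoissonMoments

/-! ### Recursive estimates for the first two moments of the age -/

namespace Network

variable {n s m : ℕ} {lamS lamE : ℝ≥0} {Ω : Type u} [MeasurableSpace Ω] {μ : Measure Ω}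
  (G : Network n s m lamS lamE μ)

/-- A function of the age at time `a` is independent of a function of the counters and selections
after time `a`. -/
lemma lintegral_pathAge_mul [IsProbabilityMeasure μ] (k : ℕ) (j : Fin m)
    (a : ℝ≥0) (φ : ℕ → ℝ≥0∞) {Z : Ω → ℝ≥0∞} (hZ : Measurable Z)
    {g : (c : ℕ) → Path m × (Set.Ioi c → Finset (Fin m)) → ℝ≥0∞} (hg : ∀ c, Measurable (g c))
    (hZg : ∀ᵐ ω ∂μ, Z ω = g (G.counter .source a ω) (G.future a (G.counter .source a ω) ω))
    {z : ℝ≥0∞} (hz : ∀ c, ∫⁻ ω, g c (G.future a c ω) ∂μ = z) :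
    ∫⁻ ω, φ (G.pathAge k j a ω) * Z ω ∂μ = (∫⁻ ω, φ (G.pathAge k j a ω) ∂μ) * z := by
  -- Versions above `c = N₀(a)` do not exist at time `a`; the empty default for them does not
  -- influence the age.
  let H : (c : ℕ) → (Set.Iic c → Finset (Fin m)) → ℕ → Finset (Fin m) := fun c p ℓ =>
    G.subscribers ∪ if h : ℓ ≤ c then p ⟨ℓ, h⟩ else ∅
  have hH : ∀ c, Measurable (H c) := by
    intro c
    refine measurable_pi_lambda _ fun ℓ => ?_
    by_cases h : ℓ ≤ c
    · simp only [H, h, dite_true]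
      exact (Measurable.of_discrete (f := fun K : Finset (Fin m) => G.subscribers ∪ K)).comp
        (measurable_pi_apply _)
    · simp only [H, h, dite_false]
      exact measurable_const
  refine G.lintegral_mul_past_future a
    (X := fun ω => φ (G.pathAge k j a ω))
    (f := fun c p => φ (Path.versionAge k j p.1 (H c p.2) a))
    ((Measurable.of_discrete (f := φ)).comp (G.measurable_pathAge k j a)) hZ (fun c => ?_) hg
    (ae_of_all _ fun ω => ?_) hZg hz
  · exact (Measurable.of_discrete (f := φ)).comp ((Path.measurable_versionAge k j a).comp
      (measurable_fst.prodMk ((hH c).comp measurable_snd)))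
  · simp only [past, Path.versionAge_upTo le_rfl]
    refine congrArg φ (Path.versionAge_congr_holders fun ℓ _ hℓ => ?_)
    have hℓ : ℓ ≤ G.counter .source a ω := hℓ
    simp [H, hℓ, holders, keyHolders]

/-- The part of the age at time `a + d` due to the versions generated after time `a`. -/
def recentAge (k : ℕ) (j : Fin m) (a d : ℝ≥0) (ω : Ω) : ℕ :=
  Path.versionAge k j ((G.path ω).shift a)
    (fun ℓ => G.holders ω ((G.path ω) .source a + ℓ)) d

lemma measurable_recentAge (k : ℕ) (j : Fin m) (a d : ℝ≥0) :
    Measurable (G.recentAge k j a d) := by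
  refine (Path.measurable_versionAge k j d).comp
    (((measurable_shift a).comp G.measurable_path).prodMk (measurable_pi_lambda _ fun ℓ => ?_))
  have h : Measurable fun p : ℕ × (ℕ → Finset (Fin m)) => p.2 (p.1 + ℓ) :=
    measurable_from_prod_countable_right fun c => measurable_pi_apply (c + ℓ)
  exact h.comp (((Path.measurable_eval .source a).comp G.measurable_path).prodMk
    G.measurable_holders)

/-- The age at `a` is determined by the past and the recent age by the future. Given `N₀(a) = c`,
the latter is the age in the network restarted from version `c`, whose mean does not depend on `c`.
-/
lemma lintegral_pathAge_mul_recentAge [IsProbabilityMeasure μ] (k : ℕ) (j : Fin m)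
    (a d : ℝ≥0) (φ : ℕ → ℝ≥0∞) :
    ∫⁻ ω, φ (G.pathAge k j a ω) * (G.recentAge k j a d ω : ℝ≥0∞) ∂μ =
      (∫⁻ ω, φ (G.pathAge k j a ω) ∂μ) * G.meanAge k j d := by
  -- After renumbering, index `0` is version `c`, which belongs to the past; its default is harmless
  -- because version `0` never affects the age.
  let H : (c : ℕ) → (Set.Ioi c → Finset (Fin m)) → ℕ → Finset (Fin m) := fun c p ℓ =>
    G.subscribers ∪ if h : 0 < ℓ then p ⟨c + ℓ, Nat.lt_add_of_pos_right h⟩ else ∅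
  have hH : ∀ c, Measurable (H c) := by
    intro c
    refine measurable_pi_lambda _ fun ℓ => ?_
    by_cases h : 0 < ℓ
    · simp only [H, h, dite_true]
      exact (Measurable.of_discrete (f := fun K : Finset (Fin m) => G.subscribers ∪ K)).comp
        (measurable_pi_apply _)
    · simp only [H, h, dite_false]
      exact measurable_const
  have hcast : Measurable fun x : ℕ => (x : ℝ≥0∞) := Measurable.of_discrete
  have hHf : ∀ c ω ℓ, 1 ≤ ℓ → G.holders ω (c + ℓ) = H c (G.future a c ω).2 ℓ := by
    intro c ω ℓ hℓ
    have : 0 < ℓ := hℓ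
    simp [H, this, holders, keyHolders, future]
  refine G.lintegral_pathAge_mul k j a φ (hcast.comp (G.measurable_recentAge k j a d))
    (g := fun c p => (Path.versionAge k j p.1 (H c p.2) d : ℝ≥0∞)) (fun c => ?_)
    (ae_of_all _ fun ω => ?_) (fun c => ?_)
  · exact hcast.comp ((Path.measurable_versionAge k j d).comp
      (measurable_fst.prodMk ((hH c).comp measurable_snd)))
  · rw [Function.comp, recentAge]
    congr 1
    exact Path.versionAge_congr_holders fun ℓ hℓ _ => hHf _ ω ℓ hℓ
  · rw [meanAge_congr G (G.shift a c) rfl k j d]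
    refine lintegral_congr fun ω => ?_
    rw [pathAge, path_shift, holders_shift]
    congr 1
    exact Path.versionAge_congr_holders fun ℓ hℓ _ => (hHf _ ω ℓ hℓ).symm

lemma lintegral_recentAge [IsProbabilityMeasure μ] (k : ℕ) (j : Fin m)
    (a d : ℝ≥0) : ∫⁻ ω, (G.recentAge k j a d ω : ℝ≥0∞) ∂μ = G.meanAge k j d := by
  simpa using G.lintegral_pathAge_mul_recentAge k j a d (fun _ => 1)

lemma measurable_silent_indicator (j : Fin m) (a d : ℝ≥0) :
    Measurable fun N : Path m => if N.Silent j a d then (1 : ℝ≥0∞) else 0 :=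
  Measurable.ite (Path.measurableSet_silent j a d) measurable_const measurable_const

lemma silent_shift (N : Path m) (j : Fin m) (a d : ℝ≥0) :
    (N.shift a).Silent j 0 d ↔ N.Silent j a (a + d) := by
  simp [Path.Silent, Path.shift, Nat.sub_eq_zero_iff_le]

lemma lintegral_pathAge_mul_silent [IsProbabilityMeasure μ] (k : ℕ) (j : Fin m)
    (a d : ℝ≥0) (φ : ℕ → ℝ≥0∞) :
    ∫⁻ ω, φ (G.pathAge k j a ω) * (if (G.path ω).Silent j a (a + d) then 1 else 0) ∂μ =
      (∫⁻ ω, φ (G.pathAge k j a ω) ∂μ) * μ {ω | (G.path ω).Silent j a (a + d)} := by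
  have hS : MeasurableSet {ω | (G.path ω).Silent j a (a + d)} :=
    G.measurable_path (Path.measurableSet_silent j a (a + d))
  refine G.lintegral_pathAge_mul k j a φ
    ((measurable_silent_indicator j a (a + d)).comp G.measurable_path)
    (g := fun c p => if p.1.Silent j 0 d then 1 else 0)
    (fun c => (measurable_silent_indicator j 0 d).comp measurable_fst)
    (ae_of_all _ fun ω => ?_) (fun c => ?_)
  · simp only [future, silent_shift]
    rfl
  · simp only [future, silent_shift]
    have := lintegral_indicator_one (μ := μ) hS
    simpa [Set.indicator_apply] using this

/-- A union bound over edges into `j`, each unactivated with the void probability of its Poisson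
increment. The factor `m` counts the impossible `i = j` as well. -/
lemma measure_silent_le (j : Fin m) (a d : ℝ≥0) :
    μ {ω | (G.path ω).Silent j a (a + d)} ≤
      m * ENNReal.ofReal (Real.exp (-((lamE / ((m - 1 : ℕ) : ℝ≥0) : ℝ≥0) * d))) := by
  have : {ω | (G.path ω).Silent j a (a + d)} ⊆ ⋃ i, {ω | ∃ h : i ≠ j,
      G.counter (.edge i j h) (a + d) ω ≤ G.counter (.edge i j h) a ω} := by
    intro ω hω
    simpa [Path.Silent, path] using hω
  refine (measure_mono this).trans ((measure_iUnion_fintype_le _ _).trans ?_)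
  have hi : ∀ i : Fin m, μ {ω | ∃ h : i ≠ j,
      G.counter (.edge i j h) (a + d) ω ≤ G.counter (.edge i j h) a ω} ≤
      ENNReal.ofReal (Real.exp (-((lamE / ((m - 1 : ℕ) : ℝ≥0) : ℝ≥0) * d))) := by
    intro i
    by_cases h : i = j
    · simp [h]
    · simp only [ne_eq, h, not_false_eq_true, exists_true_left]
      exact ((G.poisson (.edge i j h)).measure_increment_eq_zero a d).le
  refine (Finset.sum_le_sum fun i _ => hi i).trans ?_
  simp

variable {k : ℕ} {j : Fin m}

lemma Regular.recentAge_le {G : Network n s m lamS lamE μ} {ω : Ω} (hω : G.Regular ω) (a : ℚ≥0)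
    (d : ℝ≥0) : G.recentAge k j a d ω ≤ G.pathAge k j (a + d) ω :=
  Path.versionAge_shift_le hω.monotone a

lemma Regular.pathAge_le {G : Network n s m lamS lamE μ} {ω : Ω} (hω : G.Regular ω) (hkn : k < n)
    (a : ℚ≥0) (d : ℝ≥0) : G.pathAge k j (a + d) ω ≤ G.recentAge k j a d ω +
      G.pathAge k j a ω * if (G.path ω).Silent j a (a + d) then 1 else 0 := by
  have := Path.versionAge_le_shift_add (k := k) (j := j) (s := d) (H := G.holders ω) hω.monotone a
    fun ℓ _ => by rw [hω.card_holders]; exact hkn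
  rw [mul_ite, mul_one, mul_zero]
  exact this

/-- The mean age is nondecreasing. -/
lemma meanAge_le_add [IsProbabilityMeasure μ] (hsn : s ≤ n) (a : ℚ≥0) (d : ℝ≥0) :
    G.meanAge k j d ≤ G.meanAge k j (a + d) := by
  rw [← G.lintegral_recentAge k j a d]
  refine lintegral_mono_ae ?_
  filter_upwards [G.ae_regular hsn] with ω hω
  exact_mod_cast hω.recentAge_le a d

/-- The second moment of the age at time `t`. -/
def secondMoment (k : ℕ) (j : Fin m) (t : ℝ≥0) : ℝ≥0∞ :=
  ∫⁻ ω, (G.pathAge k j t ω : ℝ≥0∞) ^ 2 ∂μ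

/-- Multiply `pathAge_le` by the age at `a`: the recent part factorizes by independence, the
leftover part carries the silence probability. Replacing the mean at `d` by the larger mean at `a +
d` leaves exactly a covariance bound. -/
lemma lintegral_pathAge_mul_le [IsProbabilityMeasure μ] (hsn : s ≤ n) (hkn : k < n)
    (a : ℚ≥0) (d : ℝ≥0) :
    ∫⁻ ω, (G.pathAge k j a ω : ℝ≥0∞) * G.pathAge k j (a + d) ω ∂μ ≤
      G.meanAge k j a * G.meanAge k j (a + d) +
        G.secondMoment k j a * μ {ω | (G.path ω).Silent j a (a + d)} := by
  have e1 := G.lintegral_pathAge_mul_recentAge k j a d (fun x => (x : ℝ≥0∞))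
  have e2 := G.lintegral_pathAge_mul_silent k j a d (fun x => (x : ℝ≥0∞) ^ 2)
  have hcast : Measurable fun x : ℕ => (x : ℝ≥0∞) := Measurable.of_discrete
  have hm : Measurable fun ω =>
      (G.pathAge k j a ω : ℝ≥0∞) * (G.recentAge k j a d ω : ℝ≥0∞) :=
    (hcast.comp (G.measurable_pathAge k j a)).mul (hcast.comp (G.measurable_recentAge k j a d))
  calc _ ≤ ∫⁻ ω, (G.pathAge k j a ω : ℝ≥0∞) * (G.recentAge k j a d ω : ℝ≥0∞) +
        (G.pathAge k j a ω : ℝ≥0∞) ^ 2 * (if (G.path ω).Silent j a (a + d) then 1 else 0) ∂μ := by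
        refine lintegral_mono_ae ?_
        filter_upwards [G.ae_regular hsn] with ω hω
        have := Nat.mul_le_mul_left (G.pathAge k j a ω) (hω.pathAge_le (j := j) hkn a d)
        have h2 : G.pathAge k j a ω * G.pathAge k j (a + d) ω ≤
            G.pathAge k j a ω * G.recentAge k j a d ω +
            G.pathAge k j a ω ^ 2 * (if (G.path ω).Silent j a (a + d) then 1 else 0) := by
          refine this.trans (le_of_eq ?_)
          ring
        exact_mod_cast h2
    _ = G.meanAge k j a * G.meanAge k j d +
        G.secondMoment k j a * μ {ω | (G.path ω).Silent j a (a + d)} := by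
        rw [lintegral_add_left hm, e1, e2]
        rfl
    _ ≤ _ := by
        gcongr
        exact G.meanAge_le_add hsn a d

/-- Uses `(x + y)² ≤ 2x² + 2y²` for old and recent age: the old part is independent of silence, the
recent part is at most a Poisson increment. -/
lemma secondMoment_add_le [IsProbabilityMeasure μ] (hsn : s ≤ n) (hkn : k < n)
    (a : ℚ≥0) (d : ℝ≥0) :
    G.secondMoment k j (a + d) ≤
      2 * (G.secondMoment k j a * μ {ω | (G.path ω).Silent j a (a + d)}) +
        2 * ∫⁻ x, (x : ℝ≥0∞) ^ 2 ∂poissonMeasure (lamS * d) := by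
  have e2 := G.lintegral_pathAge_mul_silent k j a d (fun x => (x : ℝ≥0∞) ^ 2)
  have e3 := (G.poisson .source).lintegral_increment_sq a d
  have hcast : Measurable fun x : ℕ => (x : ℝ≥0∞) ^ 2 := Measurable.of_discrete
  have hm : Measurable fun ω => (G.pathAge k j a ω : ℝ≥0∞) ^ 2 *
      (if (G.path ω).Silent j a (a + d) then 1 else 0) :=
    (hcast.comp (G.measurable_pathAge k j a)).mul
      ((measurable_silent_indicator j a (a + d)).comp G.measurable_path)
  calc _ ≤ ∫⁻ ω, 2 * ((G.pathAge k j a ω : ℝ≥0∞) ^ 2 *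
        (if (G.path ω).Silent j a (a + d) then 1 else 0)) +
        2 * ((G.counter .source (a + d) ω - G.counter .source a ω : ℕ) : ℝ≥0∞) ^ 2 ∂μ := by
        refine lintegral_mono_ae ?_
        filter_upwards [G.ae_regular hsn] with ω hω
        have h1 := hω.pathAge_le (j := j) hkn a d
        have h2 : G.recentAge k j a d ω ≤ G.counter .source (a + d) ω - G.counter .source a ω :=
          Path.versionAge_le_increment _
        have h3 : G.pathAge k j (a + d) ω ^ 2 ≤ 2 * (G.pathAge k j a ω ^ 2 *
            (if (G.path ω).Silent j a (a + d) then 1 else 0)) +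
            2 * (G.counter .source (a + d) ω - G.counter .source a ω) ^ 2 := by
          refine (Nat.pow_le_pow_left (h1.trans (Nat.add_le_add_right h2 _)) 2).trans ?_
          refine add_sq_le.trans (le_of_eq ?_)
          split_ifs <;> ring
        exact_mod_cast h3
    _ = _ := by
        rw [lintegral_add_left (hm.const_mul 2), lintegral_const_mul _ hm, e2,
          lintegral_const_mul', e3]
        · rfl
        · exact ENNReal.ofNat_ne_top

end Network

/-! ### From grid averages to time averages -/

section TimeAverage

variable {f d : ℝ → ℝ}

lemma intervalIntegrable_sub (hf : Monotone f) (hd : Monotone d) (a b : ℝ) :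
    IntervalIntegrable (fun t => f t - d t) volume a b :=
  (hf.intervalIntegrable).sub (hd.intervalIntegrable)

/-- On each cell the integrand is at most `f` at the right end minus `d` at the left end; the
resulting errors in `f` telescope. -/
lemma integral_grid_le (hf : Monotone f) (hd : Monotone d) {h : ℝ} (hh : 0 ≤ h) (Q : ℕ) :
    ∫ t in (0 : ℝ)..(Q * h), (f t - d t) ≤
      h * (∑ i ∈ Finset.range Q, (f (i * h) - d (i * h)) + (f (Q * h) - f 0)) := by
  induction Q with
  | zero => simp
  | succ Q ih =>
    have hle : (Q : ℝ) * h ≤ ((Q + 1 : ℕ) : ℝ) * h := by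
      push_cast
      nlinarith
    rw [← intervalIntegral.integral_add_adjacent_intervals (b := (Q : ℝ) * h)
      (intervalIntegrable_sub hf hd _ _) (intervalIntegrable_sub hf hd _ _), Finset.sum_range_succ]
    have h1 : ∫ t in ((Q : ℝ) * h)..(((Q + 1 : ℕ) : ℝ) * h), (f t - d t) ≤
        ∫ _ in ((Q : ℝ) * h)..(((Q + 1 : ℕ) : ℝ) * h),
          (f (((Q + 1 : ℕ) : ℝ) * h) - d (Q * h)) :=
      intervalIntegral.integral_mono_on hle (intervalIntegrable_sub hf hd _ _)
        intervalIntegrable_const fun t ht => sub_le_sub (hf ht.2) (hd ht.1)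
    rw [intervalIntegral.integral_const, smul_eq_mul] at h1
    push_cast at h1 ⊢
    linarith

/-- Here the cell is compared with the value at its right end, and the loss is again an increment of
`f`. -/
lemma le_integral_grid (hf : Monotone f) (hd : Monotone d) {h : ℝ} (hh : 0 ≤ h) (Q : ℕ) :
    h * (∑ i ∈ Finset.range (Q + 1), (f (i * h) - d (i * h)) - (f 0 - d 0)
      - (f (Q * h) - f 0)) ≤ ∫ t in (0 : ℝ)..(Q * h), (f t - d t) := by
  induction Q with
  | zero => simp
  | succ Q ih =>
    have hle : (Q : ℝ) * h ≤ ((Q + 1 : ℕ) : ℝ) * h := by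
      push_cast
      nlinarith
    rw [← intervalIntegral.integral_add_adjacent_intervals (b := (Q : ℝ) * h)
      (intervalIntegrable_sub hf hd _ _) (intervalIntegrable_sub hf hd _ _), Finset.sum_range_succ]
    have h1 : ∫ _ in ((Q : ℝ) * h)..(((Q + 1 : ℕ) : ℝ) * h),
          (f (Q * h) - d (((Q + 1 : ℕ) : ℝ) * h)) ≤
        ∫ t in ((Q : ℝ) * h)..(((Q + 1 : ℕ) : ℝ) * h), (f t - d t) :=
      intervalIntegral.integral_mono_on hle intervalIntegrable_const
        (intervalIntegrable_sub hf hd _ _) fun t ht => sub_le_sub (hf ht.1) (hd ht.2)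
    rw [intervalIntegral.integral_const, smul_eq_mul] at h1
    push_cast at h1 ih ⊢
    linarith

set_option maxHeartbeats 400000 in
/-- The time average of a nonnegative difference of nondecreasing functions can be computed
along all the grids `{i / p}`. -/
theorem tendsto_time_average (hf : Monotone f) (hd : Monotone d) (hdf : ∀ t, d t ≤ f t)
    (hf0 : 0 ≤ f 0) {B c : ℝ} (hB0 : 0 ≤ B) (hB : ∀ n : ℕ, f n ≤ B * (n + 1))
    (hgrid : ∀ p : ℕ, Tendsto (fun Q : ℕ => (∑ i ∈ Finset.range Q,
      (f (i * (1 / ((p : ℝ) + 1))) - d (i * (1 / ((p : ℝ) + 1))))) / Q) atTop (𝓝 c)) :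
    Tendsto (fun T : ℝ => (1 / T) * ∫ t in (0 : ℝ)..T, (f t - d t)) atTop (𝓝 c) := by
  have hB' : ∀ x : ℝ, 0 ≤ x → f x ≤ B * (x + 2) := fun x hx => by
    refine (hf (Nat.le_ceil x)).trans ((hB _).trans ?_)
    have := (Nat.ceil_lt_add_one hx).le
    nlinarith
  have hImono : ∀ a b : ℝ, 0 ≤ a → a ≤ b →
      ∫ t in (0 : ℝ)..a, (f t - d t) ≤ ∫ t in (0 : ℝ)..b, (f t - d t) := fun a b ha hab =>
    intervalIntegral.integral_mono_interval le_rfl ha hab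
      (ae_of_all _ fun t => sub_nonneg.2 (hdf t)) (intervalIntegrable_sub hf hd _ _)
  rw [Metric.tendsto_nhds]
  intro ε hε
  -- The telescoped error is `h * f`, of order `h * B * T`; this mesh makes it at most about `ε / 8
  -- * T`.
  obtain ⟨p, hp⟩ := exists_nat_one_div_lt (show 0 < ε / (8 * (B + 1)) by positivity)
  set h : ℝ := 1 / ((p : ℝ) + 1) with hh
  have hh0 : 0 < h := by positivity
  have hh1 : h ≤ 1 := by
    rw [hh, div_le_one (by positivity)]
    linarith [(Nat.cast_nonneg p : (0 : ℝ) ≤ p)]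
  have hBh : B * h ≤ ε / 8 := by
    rw [lt_div_iff₀ (by positivity)] at hp
    nlinarith
  obtain ⟨Q₀, hQ₀⟩ := Filter.eventually_atTop.1
    ((Metric.tendsto_nhds.1 (hgrid p)) (ε / 8) (by positivity))
  set a0 := f 0 - d 0 with ha0
  have ha0' : 0 ≤ a0 := sub_nonneg.2 (hdf 0)
  -- Collects the errors that do not grow with `T`: rounding `T` to the grid, the initial term, and
  -- additive constants.
  set C := |c| + a0 + ε * 2 with hC
  filter_upwards [eventually_ge_atTop (((Q₀ : ℝ) + 1) * h), eventually_gt_atTop 0,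
    eventually_ge_atTop (4 * C / ε)] with T hT1 hT0 hT2
  have hCT : C ≤ ε / 4 * T := by
    rw [div_le_iff₀ hε] at hT2
    linarith
  set Q := ⌊T / h⌋₊ with hQ
  have hQ1 : (Q : ℝ) * h ≤ T := by
    rw [← le_div_iff₀ hh0]
    exact Nat.floor_le (by positivity)
  have hQ2 : T ≤ ((Q + 1 : ℕ) : ℝ) * h := by
    rw [← div_le_iff₀ hh0]
    push_cast
    exact (Nat.lt_floor_add_one _).le
  have hQ0 : Q₀ + 1 ≤ Q := by
    refine Nat.le_floor ?_
    push_cast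
    rwa [le_div_iff₀ hh0]
  have hS : ∀ R : ℕ, Q ≤ R → |∑ i ∈ Finset.range R, (f (i * h) - d (i * h)) - c * R| ≤
      ε / 8 * R := by
    intro R hR
    have hRpos : (0 : ℝ) < R := by
      have : 0 < R := by omega
      exact_mod_cast this
    have h1 := hQ₀ R (by omega)
    rw [Real.dist_eq, div_sub' hRpos.ne', abs_div, abs_of_pos hRpos, div_lt_iff₀ hRpos] at h1
    rw [mul_comm c]
    exact h1.le
  have hup := (hImono T _ hT0.le hQ2).trans (integral_grid_le hf hd hh0.le (Q + 1))
  have hlow := (le_integral_grid hf hd hh0.le Q).trans (hImono _ T (by positivity) hQ1)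
  have hS1 := abs_le.1 (hS (Q + 1) (by omega))
  have hQ3 : ((Q + 1 : ℕ) : ℝ) * h ≤ T + 1 := by
    push_cast
    linarith
  have hf1 := hB' (((Q + 1 : ℕ) : ℝ) * h) (by positivity)
  have hf2 := hB' ((Q : ℝ) * h) (by positivity)
  set I := ∫ t in (0 : ℝ)..T, (f t - d t) with hI
  set S := ∑ i ∈ Finset.range (Q + 1), (f (i * h) - d (i * h)) with hSdef
  set R : ℝ := ((Q + 1 : ℕ) : ℝ) with hR
  have hcR : |c * (R * h) - c * T| ≤ |c| := by
    rw [← mul_sub, abs_mul]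
    refine mul_le_of_le_one_right (abs_nonneg _) (abs_le.2 ⟨by linarith, by linarith⟩)
  have hcR' := abs_le.1 hcR
  have h1 : h * S ≤ c * (R * h) + ε / 8 * (R * h) := by
    linarith [mul_le_mul_of_nonneg_left hS1.2 hh0.le]
  have h2 : c * (R * h) - ε / 8 * (R * h) ≤ h * S := by
    linarith [mul_le_mul_of_nonneg_left hS1.1 hh0.le]
  have h3 : ε / 8 * (R * h) ≤ ε / 8 * (T + 1) := by gcongr
  have hRB : h * f (R * h) ≤ ε / 8 * (T + 3) := by
    calc h * f (R * h) ≤ h * (B * (R * h + 2)) := by gcongr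
      _ = (B * h) * (R * h + 2) := by ring
      _ ≤ ε / 8 * (T + 3) := mul_le_mul hBh (by linarith) (by positivity) (by positivity)
  have hQB : h * f (Q * h) ≤ ε / 8 * (T + 2) := by
    calc h * f (Q * h) ≤ h * (B * (Q * h + 2)) := by gcongr
      _ = (B * h) * (Q * h + 2) := by ring
      _ ≤ ε / 8 * (T + 2) := mul_le_mul hBh (by linarith) (by positivity) (by positivity)
  have h4 : h * f 0 ≥ 0 := by positivity
  have h5 : h * a0 ≤ a0 := mul_le_of_le_one_left ha0' hh1
  have hupper : I - c * T ≤ ε / 4 * T + C := by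
    rw [hC]
    linarith
  have hlower : -(ε / 4 * T + C) ≤ I - c * T := by
    rw [hC]
    linarith
  rw [Real.dist_eq]
  have : 1 / T * I - c = (I - c * T) / T := by field_simp
  rw [this, abs_div, abs_of_pos hT0, div_lt_iff₀ hT0, abs_lt]
  have hεT := mul_pos hε hT0
  constructor <;> linarith

end TimeAverage

/-! ### Bounded second moments, decaying covariances, existence of the time average -/

namespace Network

variable {n s m : ℕ} {lamS lamE : ℝ≥0} {Ω : Type u} [MeasurableSpace Ω] {μ : Measure Ω}
  (G : Network n s m lamS lamE μ) {k : ℕ} {j : Fin m}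

/-- The second moments of the age are bounded. -/
lemma exists_secondMoment_le [IsProbabilityMeasure μ] (hsn : s ≤ n) (hkn : k < n) (hnm : 2 ≤ m)
    (hE : 0 < lamE) : ∃ C : ℝ≥0, ∀ t : ℚ≥0, G.secondMoment k j t ≤ C := by
  set e : ℝ≥0 := lamE / ((m - 1 : ℕ) : ℝ≥0) with he
  have hm1 : (0 : ℝ≥0) < ((m - 1 : ℕ) : ℝ≥0) := by
    have : 0 < m - 1 := by omega
    exact_mod_cast this
  have he0 : (0 : ℝ) < e := NNReal.coe_pos.2 (div_pos hE hm1)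
  -- A time step so long that silence has probability at most `1 / 4`, which beats the factor `2` in
  -- `secondMoment_add_le`.
  obtain ⟨L, hL⟩ : ∃ L : ℕ, (m : ℝ) * Real.exp (-(e * (L : ℝ))) ≤ 1 / 4 := by
    have h1 : Tendsto (fun L : ℕ => (m : ℝ) * Real.exp (-(e * (L : ℝ)))) atTop (𝓝 (m * 0)) := by
      refine tendsto_const_nhds.mul (Real.tendsto_exp_neg_atTop_nhds_zero.comp ?_)
      exact tendsto_natCast_atTop_atTop.const_mul_atTop he0
    rw [mul_zero] at h1
    exact (h1.eventually_le_const (by norm_num)).exists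
  have hLpos : 0 < L := by
    rcases Nat.eq_zero_or_pos L with h | h
    · subst h
      have : (2 : ℝ) ≤ m := by exact_mod_cast hnm
      norm_num at hL
      linarith
    · exact h
  set v : ℝ≥0∞ := ∫⁻ x, (x : ℝ≥0∞) ^ 2 ∂poissonMeasure (lamS * (L : ℝ≥0)) with hv
  have hvtop : v ≠ ∞ := lintegral_sq_poissonMeasure_ne_top _
  have hsil : ∀ a : ℝ≥0, μ {ω | (G.path ω).Silent j a (a + (L : ℝ≥0))} ≤ 4⁻¹ := by
    intro a
    refine (G.measure_silent_le j a L).trans ?_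
    rw [← ENNReal.ofReal_natCast, ← ENNReal.ofReal_mul (by positivity),
      show (4 : ℝ≥0∞)⁻¹ = ENNReal.ofReal (1 / 4) by
        rw [one_div, ENNReal.ofReal_inv_of_pos (by norm_num)]; norm_num]
    refine ENNReal.ofReal_le_ofReal ?_
    simpa [he] using hL
  -- The bound `4 * v` is the fixed point of `x ↦ 2 * (x / 4) + 2 * v`, the recursion over one step
  -- of length `L`.
  have key : ∀ i : ℕ, ∀ t : ℚ≥0, t ≤ i * L → G.secondMoment k j t ≤ 4 * v := by
    intro i
    induction i with
    | zero =>
      intro t ht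
      have ht0 : t = 0 := by simpa using ht
      subst ht0
      have : G.secondMoment k j ((0 : ℚ≥0) : ℝ≥0) = 0 := by
        rw [secondMoment, lintegral_eq_zero_iff']
        · filter_upwards [G.ae_regular hsn] with ω hω
          have h1 : G.pathAge k j 0 ω ≤ G.counter .source 0 ω := Path.versionAge_le
          rw [hω.zero] at h1
          simp [Nat.le_zero.1 h1]
        · exact ((Measurable.of_discrete (f := fun x : ℕ => (x : ℝ≥0∞) ^ 2)).comp
            (G.measurable_pathAge k j _)).aemeasurable
      rw [this]
      exact zero_le
    | succ i ih =>
      intro t ht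
      by_cases htL : t ≤ L
      · have hbase : G.secondMoment k j t ≤ v := by
          have e3 := (G.poisson .source).lintegral_increment_sq 0 L
          rw [Counter.rate, ← hv] at e3
          rw [← e3]
          refine lintegral_mono_ae ?_
          filter_upwards [G.ae_regular hsn] with ω hω
          have h1 : G.pathAge k j t ω ≤ G.counter .source t ω := Path.versionAge_le
          have h2 : G.counter .source t ω ≤ G.counter .source (0 + L) ω :=
            hω.monotone .source (by rw [zero_add]; exact_mod_cast htL)
          rw [hω.zero, Nat.sub_zero]
          gcongr
          exact h1.trans h2
        refine hbase.trans ?_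
        exact le_mul_of_one_le_left zero_le (by norm_num)
      · obtain ⟨a, rfl⟩ := exists_add_of_le (not_le.1 htL).le
        have ha : a ≤ i * L := by
          push_cast at ht
          rw [add_mul, one_mul, add_comm] at ht
          exact le_of_add_le_add_right ht
        have h1 := G.secondMoment_add_le (j := j) hsn hkn a L
        rw [← hv] at h1
        have hcast : (((L : ℚ≥0) + a : ℚ≥0) : ℝ≥0) = (a : ℝ≥0) + (L : ℝ≥0) := by
          push_cast
          ring
        rw [hcast]
        refine h1.trans ?_
        calc _ ≤ 2 * (4 * v * 4⁻¹) + 2 * v := by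
              gcongr
              · exact ih a ha
              · exact hsil a
          _ = 4 * v := by
              rw [mul_comm 4 v, mul_assoc, ENNReal.mul_inv_cancel (by norm_num) (by norm_num)]
              ring
  have htop : 4 * v ≠ ∞ := ENNReal.mul_ne_top (by norm_num) hvtop
  refine ⟨(4 * v).toNNReal, fun t => ?_⟩
  rw [ENNReal.coe_toNNReal htop]
  obtain ⟨i, hi⟩ := exists_nat_ge t
  refine key i t (hi.trans ?_)
  have : (1 : ℚ≥0) ≤ L := by exact_mod_cast hLpos
  exact le_mul_of_one_le_right (by positivity) this

lemma meanAge_le_secondMoment (t : ℝ≥0) : G.meanAge k j t ≤ G.secondMoment k j t := by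
  refine lintegral_mono fun ω => ?_
  have : G.pathAge k j t ω ≤ G.pathAge k j t ω ^ 2 := Nat.le_self_pow two_ne_zero _
  calc (G.pathAge k j t ω : ℝ≥0∞) ≤ ((G.pathAge k j t ω ^ 2 : ℕ) : ℝ≥0∞) := Nat.cast_le.2 this
    _ = _ := Nat.cast_pow _ _

lemma meanAge_mono [IsProbabilityMeasure μ] (hsn : s ≤ n) :
    Monotone fun t : ℚ≥0 => G.meanAge k j t := by
  intro t t' htt
  obtain ⟨a, rfl⟩ := exists_add_of_le htt
  have := G.meanAge_le_add (k := k) (j := j) hsn a t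
  rw [add_comm] at this
  simpa using this

/-- The limit of the mean age. -/
def limitAge (k : ℕ) (j : Fin m) : ℝ≥0∞ := ⨆ t : ℚ≥0, G.meanAge k j t

lemma limitAge_ne_top [IsProbabilityMeasure μ] (hsn : s ≤ n) (hkn : k < n) (hnm : 2 ≤ m)
    (hE : 0 < lamE) : G.limitAge k j ≠ ∞ := by
  obtain ⟨C, hC⟩ := G.exists_secondMoment_le (j := j) hsn hkn hnm hE
  exact ne_top_of_le_ne_top ENNReal.coe_ne_top
    (iSup_le fun t => (G.meanAge_le_secondMoment t).trans (hC t))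

lemma tendsto_meanAge [IsProbabilityMeasure μ] (hsn : s ≤ n) {h : ℚ≥0} (hh : 0 < h) :
    Tendsto (fun i : ℕ => G.meanAge k j ((i * h : ℚ≥0) : ℝ≥0)) atTop (𝓝 (G.limitAge k j)) := by
  have h1 : Tendsto (fun i : ℕ => (i : ℚ≥0) * h) atTop atTop :=
    tendsto_natCast_atTop_atTop.atTop_mul_const hh
  exact (tendsto_atTop_iSup (G.meanAge_mono hsn)).comp h1

lemma integral_pathAge (t : ℝ≥0) :
    ∫ ω, (G.pathAge k j t ω : ℝ) ∂μ = (G.meanAge k j t).toReal := by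
  rw [integral_eq_lintegral_of_nonneg_ae (ae_of_all _ fun ω => by positivity)]
  · simp [meanAge]
  · exact ((Measurable.of_discrete (f := fun x : ℕ => (x : ℝ))).comp
      (G.measurable_pathAge k j t)).aestronglyMeasurable

lemma memLp_pathAge [IsProbabilityMeasure μ] {t : ℝ≥0} (h : G.secondMoment k j t ≠ ∞) :
    MemLp (fun ω => (G.pathAge k j t ω : ℝ)) 2 μ := by
  have hm : AEStronglyMeasurable (fun ω => (G.pathAge k j t ω : ℝ)) μ :=
    ((Measurable.of_discrete (f := fun x : ℕ => (x : ℝ))).comp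
      (G.measurable_pathAge k j t)).aestronglyMeasurable
  rw [memLp_two_iff_integrable_sq hm]
  refine ⟨hm.pow 2, ?_⟩
  rw [hasFiniteIntegral_iff_ofReal (ae_of_all _ fun ω => sq_nonneg _)]
  refine lt_of_le_of_lt (le_of_eq ?_) (lt_top_iff_ne_top.2 h)
  refine lintegral_congr fun ω => ?_
  rw [ENNReal.ofReal_pow (by positivity), ENNReal.ofReal_natCast]

lemma integral_pathAge_mul (t t' : ℝ≥0) :
    ∫ ω, (G.pathAge k j t ω : ℝ) * G.pathAge k j t' ω ∂μ =
      (∫⁻ ω, (G.pathAge k j t ω : ℝ≥0∞) * G.pathAge k j t' ω ∂μ).toReal := by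
  have hc : Measurable fun x : ℕ => (x : ℝ) := Measurable.of_discrete
  rw [integral_eq_lintegral_of_nonneg_ae (ae_of_all _ fun ω => by positivity)]
  · congr 1
    refine lintegral_congr fun ω => ?_
    rw [ENNReal.ofReal_mul (by positivity), ENNReal.ofReal_natCast, ENNReal.ofReal_natCast]
  · exact ((hc.comp (G.measurable_pathAge k j t)).mul
      (hc.comp (G.measurable_pathAge k j t'))).aestronglyMeasurable

/-- The product of the means cancels in `lintegral_pathAge_mul_le`, leaving the bounded second
moment times the silence probability. -/
lemma covariance_pathAge_le [IsProbabilityMeasure μ] (hsn : s ≤ n) (hkn : k < n) {C : ℝ≥0}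
    (hC : ∀ t : ℚ≥0, G.secondMoment k j t ≤ C) (a d : ℚ≥0) :
    covariance (fun ω => (G.pathAge k j a ω : ℝ)) (fun ω => (G.pathAge k j (a + d : ℚ≥0) ω : ℝ)) μ
      ≤ C * m * Real.exp (-((lamE / ((m - 1 : ℕ) : ℝ≥0) : ℝ≥0) * (d : ℝ))) := by
  have hfin : ∀ t : ℚ≥0, G.secondMoment k j t ≠ ∞ := fun t =>
    ne_top_of_le_ne_top ENNReal.coe_ne_top (hC t)
  have hfin' : ∀ t : ℚ≥0, G.meanAge k j t ≠ ∞ := fun t =>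
    ne_top_of_le_ne_top (hfin t) (G.meanAge_le_secondMoment t)
  rw [covariance_eq_sub (G.memLp_pathAge (hfin _)) (G.memLp_pathAge (hfin _))]
  have h1 := G.lintegral_pathAge_mul_le (j := j) hsn hkn a d
  have hcast : ((a + d : ℚ≥0) : ℝ≥0) = (a : ℝ≥0) + (d : ℝ≥0) := by push_cast; rfl
  rw [← hcast] at h1
  set E : ℝ := Real.exp (-((lamE / ((m - 1 : ℕ) : ℝ≥0) : ℝ≥0) * (d : ℝ))) with hEdef
  have h2 : μ {ω | (G.path ω).Silent j a ((a + d : ℚ≥0) : ℝ≥0)} ≤ m * ENNReal.ofReal E := by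
    rw [hcast]
    exact G.measure_silent_le j a d
  have h3 : ∫⁻ ω, (G.pathAge k j a ω : ℝ≥0∞) * G.pathAge k j (a + d : ℚ≥0) ω ∂μ ≤
      G.meanAge k j a * G.meanAge k j (a + d : ℚ≥0) + C * (m * ENNReal.ofReal E) := by
    refine h1.trans ?_
    gcongr
    exact hC a
  have htop1 := ENNReal.mul_ne_top (hfin' a) (hfin' (a + d))
  have htop2 : (C : ℝ≥0∞) * (m * ENNReal.ofReal E) ≠ ∞ :=
    ENNReal.mul_ne_top ENNReal.coe_ne_top
      (ENNReal.mul_ne_top (ENNReal.natCast_ne_top m) ENNReal.ofReal_ne_top)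
  have h4 := ENNReal.toReal_mono (ENNReal.add_ne_top.2 ⟨htop1, htop2⟩) h3
  rw [ENNReal.toReal_add htop1 htop2, ENNReal.toReal_mul, ENNReal.toReal_mul, ENNReal.toReal_mul,
    ENNReal.toReal_ofReal (Real.exp_pos _).le, ENNReal.coe_toReal, ENNReal.toReal_natCast,
    ← G.integral_pathAge_mul] at h4
  simp only [Pi.mul_apply]
  rw [G.integral_pathAge, G.integral_pathAge]
  linarith

/-- The averages of the age along a grid of times. -/
lemma ae_tendsto_grid [IsProbabilityMeasure μ] (hsn : s ≤ n) (hkn : k < n) (hnm : 2 ≤ m)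
    (hE : 0 < lamE) {h : ℚ≥0} (hh : 0 < h) :
    ∀ᵐ ω ∂μ, Tendsto (fun Q : ℕ => (∑ i ∈ Finset.range Q,
      (G.pathAge k j ((i * h : ℚ≥0) : ℝ≥0) ω : ℝ)) / Q) atTop (𝓝 (G.limitAge k j).toReal) := by
  obtain ⟨C, hC⟩ := G.exists_secondMoment_le (j := j) hsn hkn hnm hE
  have hfin : ∀ t : ℚ≥0, G.secondMoment k j t ≠ ∞ := fun t =>
    ne_top_of_le_ne_top ENNReal.coe_ne_top (hC t)
  set e : ℝ≥0 := lamE / ((m - 1 : ℕ) : ℝ≥0) with he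
  have hm1 : (0 : ℝ≥0) < ((m - 1 : ℕ) : ℝ≥0) := by
    have : 0 < m - 1 := by omega
    exact_mod_cast this
  have he0 : (0 : ℝ) < e := NNReal.coe_pos.2 (div_pos hE hm1)
  have hh' : (0 : ℝ) < h := by exact_mod_cast hh
  have hX : ∀ i : ℕ, MemLp (fun ω => (G.pathAge k j ((i * h : ℚ≥0) : ℝ≥0) ω : ℝ)) 2 μ :=
    fun i => G.memLp_pathAge (hfin _)
  refine ae_tendsto_average (X := fun i ω => (G.pathAge k j ((i * h : ℚ≥0) : ℝ≥0) ω : ℝ))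
    (fun i ω => by positivity) hX
    (variance_sum_le_of_covariance_le hX (K := C * m) (ρ := Real.exp (-(e * h))) (by positivity)
      (Real.exp_pos _).le (Real.exp_lt_one_iff.2 (by linarith [mul_pos he0 hh'])) ?_) ?_
  · intro i d
    have := G.covariance_pathAge_le hsn hkn hC (i * h) (d * h)
    rw [show (i : ℚ≥0) * h + d * h = ((i + d : ℕ) : ℚ≥0) * h by push_cast; ring] at this
    refine this.trans (le_of_eq ?_)
    rw [← Real.exp_nat_mul, ← he]
    congr 2
    push_cast
    ring
  · simp only [G.integral_pathAge]
    exact (ENNReal.tendsto_toReal (G.limitAge_ne_top hsn hkn hnm hE)).comp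
      (G.tendsto_meanAge hsn hh)

/-- The number of versions grows at most linearly. -/
lemma ae_exists_source_le [IsProbabilityMeasure μ] (hsn : s ≤ n) :
    ∀ᵐ ω ∂μ, ∃ B : ℝ, 0 ≤ B ∧ ∀ i : ℕ, (G.counter .source i ω : ℝ) ≤ B * (i + 1) := by
  let X : ℕ → Ω → ℝ := fun i ω =>
    ((G.counter .source ((i + 1 : ℕ) : ℝ≥0) ω - G.counter .source (i : ℝ≥0) ω : ℕ) : ℝ)
  have hc : Measurable fun x : ℕ => (x : ℝ) := Measurable.of_discrete
  have hmono : Monotone fun i : ℕ => (i : ℝ≥0) := Nat.mono_cast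
  have hinc := (G.poisson .source).indepIncrements.nat hmono
  have hlaw : ∀ i : ℕ, HasLaw (X i) ((poissonMeasure (lamS * 1)).map fun x : ℕ => (x : ℝ)) μ := by
    intro i
    have := (G.poisson .source).law_increment (i : ℝ≥0) ((i + 1 : ℕ) : ℝ≥0) (hmono (Nat.le_succ i))
    rw [Nat.cast_succ, add_tsub_cancel_left] at this
    have h2 : HasLaw (fun x : ℕ => (x : ℝ)) ((poissonMeasure (lamS * 1)).map fun x : ℕ => (x : ℝ))
      (poissonMeasure (lamS * 1)) := ⟨hc.aemeasurable, rfl⟩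
    have h3 := h2.comp this
    simpa [X, Function.comp_def] using h3
  have hint : Integrable (X 0) μ := by
    have hm : Measurable (X 0) := hc.comp ((G.poisson .source).measurable_increment _ _)
    refine MemLp.integrable one_le_two ((memLp_two_iff_integrable_sq hm.aestronglyMeasurable).2 ?_)
    refine ⟨hm.aestronglyMeasurable.pow 2, ?_⟩
    rw [hasFiniteIntegral_iff_ofReal (ae_of_all _ fun ω => sq_nonneg _)]
    have h1 := (G.poisson .source).lintegral_increment_sq 0 1
    have h2 := lintegral_sq_poissonMeasure_ne_top (Counter.rate (m := m) lamS lamE .source * 1)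
    rw [← h1] at h2
    refine lt_of_le_of_lt (le_of_eq ?_) (lt_top_iff_ne_top.2 h2)
    refine lintegral_congr fun ω => ?_
    rw [ENNReal.ofReal_pow (by positivity), ENNReal.ofReal_natCast]
    simp
  have hsl := strong_law_ae_real X hint
    (fun i i' hii => (hinc.indepFun hii).comp hc hc)
    (fun i => ⟨(hlaw i).aemeasurable, (hlaw 0).aemeasurable,
      (hlaw i).map_eq.trans (hlaw 0).map_eq.symm⟩)
  filter_upwards [hsl, G.ae_regular hsn] with ω hω hreg
  obtain ⟨B, hB⟩ := hω.bddAbove_range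
  refine ⟨max B 0, le_max_right _ _, fun i => ?_⟩
  have hsum : ∑ l ∈ Finset.range i, X l ω = (G.counter .source i ω : ℝ) := by
    have := sum_Ico_sub_of_monotone (f := fun i : ℕ => G.counter .source (i : ℝ≥0) ω)
      (fun a b hab => hreg.monotone .source (hmono hab)) (Nat.zero_le i)
    rw [Nat.Ico_zero_eq_range, Nat.cast_zero, hreg.zero, Nat.sub_zero] at this
    rw [← this, Nat.cast_sum]
  have h1 := hB ⟨i, rfl⟩
  simp only [hsum] at h1
  rcases Nat.eq_zero_or_pos i with h0 | h0
  · subst h0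
    simp [hreg.zero]
  · have hi : (0 : ℝ) < i := by exact_mod_cast h0
    rw [div_le_iff₀ hi] at h1
    have h2 : B * i ≤ max B 0 * i := mul_le_mul_of_nonneg_right (le_max_left _ _) hi.le
    have h3 : 0 ≤ max B 0 := le_max_right _ _
    linarith

/-- The time average of the age exists almost surely. -/
theorem hasTimeAverageAge [IsProbabilityMeasure μ] (hsn : s ≤ n) (hkn : k < n) (hnm : 2 ≤ m)
    (hE : 0 < lamE) : G.HasTimeAverageAge k j (G.limitAge k j).toReal := by
  have hgrid : ∀ᵐ ω ∂μ, ∀ p : ℕ, Tendsto (fun Q : ℕ => (∑ i ∈ Finset.range Q,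
      (G.pathAge k j ((i * (1 / ((p : ℚ≥0) + 1)) : ℚ≥0) : ℝ≥0) ω : ℝ)) / Q) atTop
        (𝓝 (G.limitAge k j).toReal) :=
    ae_all_iff.2 fun p => G.ae_tendsto_grid hsn hkn hnm hE (by positivity)
  filter_upwards [hgrid, G.ae_exists_source_le hsn, G.ae_regular hsn] with ω h1 h2 hω
  obtain ⟨B, hB0, hB⟩ := h2
  let f : ℝ → ℝ := fun t => (G.path ω .source t.toNNReal : ℝ)
  let d : ℝ → ℝ := fun t => (Path.decoded k j (G.path ω) (G.holders ω) t.toNNReal : ℝ)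
  have hf : Monotone f := fun a b hab => by
    simp only [f]
    exact_mod_cast hω.monotone .source (Real.toNNReal_mono hab)
  have hd : Monotone d := fun a b hab => by
    simp only [d]
    exact_mod_cast Path.decoded_mono hω.monotone (Real.toNNReal_mono hab)
  have hfd : (fun v : ℝ => G.age k j v.toNNReal ω) = fun v => f v - d v := by
    funext v
    exact hω.age_eq k j _
  rw [hfd]
  refine ⟨fun t => intervalIntegrable_sub hf hd 0 t, ?_⟩
  refine tendsto_time_average hf hd (fun t => ?_) (by positivity) hB0 (fun i => ?_) fun p => ?_
  · simp only [f, d]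
    exact_mod_cast Path.decoded_le
  · simp only [f, Real.toNNReal_natCast]
    exact hB i
  · refine (h1 p).congr fun Q => ?_
    congr 1
    refine Finset.sum_congr rfl fun i _ => ?_
    have ht : ((i : ℝ) * (1 / ((p : ℝ) + 1))).toNNReal =
        ((i * (1 / ((p : ℚ≥0) + 1)) : ℚ≥0) : ℝ≥0) := by
      refine NNReal.eq ?_
      rw [Real.coe_toNNReal _ (by positivity)]
      push_cast
      rfl
    simp only [f, d, ht]
    have := Path.versionAge_add_decoded (k := k) (j := j) (N := G.path ω) (H := G.holders ω)
      (t := ((i * (1 / ((p : ℚ≥0) + 1)) : ℚ≥0) : ℝ≥0))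
    rw [← this, pathAge]
    push_cast
    ring

end Network

/-! ### Relabelling of nodes and comparison of networks -/

/-- A permutation carrying one finite set to another of the same size, and a given point to a
given point. -/
lemma exists_perm {m : ℕ} {S S' : Finset (Fin m)} (hS : S.card = S'.card) {j j' : Fin m}
    (hj : j ∈ S ↔ j' ∈ S') : ∃ σ : Equiv.Perm (Fin m), σ j = j' ∧ ∀ i, σ i ∈ S' ↔ i ∈ S := by
  have e : {i // i ∈ S} ≃ {i // i ∈ S'} := Fintype.equivOfCardEq (by simpa using hS)
  have he : ∀ i, e.extendSubtype i ∈ S' ↔ i ∈ S := fun i =>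
    ⟨fun h => by_contra fun h' => e.extendSubtype_not_mem i h' h, e.extendSubtype_mem i⟩
  -- The final swap moves the image of `j` to `j'`; both lie on the same side of `S'`, so membership
  -- is preserved.
  refine ⟨e.extendSubtype.trans (Equiv.swap (e.extendSubtype j) j'), by simp, fun i => ?_⟩
  rw [← he i, Equiv.trans_apply]
  by_cases h1 : e.extendSubtype i = e.extendSubtype j
  · rw [h1, Equiv.swap_apply_left, he j, hj]
  · by_cases h2 : e.extendSubtype i = j'
    · rw [h2, Equiv.swap_apply_right, he j, hj]
    · rw [Equiv.swap_apply_of_ne_of_ne h1 h2]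

lemma map_uniformOn {α β : Type*} [MeasurableSpace α] [MeasurableSpace β]
    [MeasurableSingletonClass α] [MeasurableSingletonClass β] {f : α → β} (hf : Measurable f)
    (hinj : Function.Injective f) {A : Set α} (hA : A.Finite) :
    (uniformOn A).map f = uniformOn (f '' A) := by
  ext t ht
  rw [Measure.map_apply hf ht, uniformOn, uniformOn, cond_apply hA.measurableSet,
    cond_apply (hA.image f).measurableSet, Measure.count_injective_image hinj,
    ← Set.image_inter_preimage, Measure.count_injective_image hinj]

/-- The counter of the relabelled edge. -/
def Counter.relabel {m : ℕ} (σ : Equiv.Perm (Fin m)) : Counter m → Counter m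
  | .source => .source
  | .edge i j h => .edge (σ i) (σ j) (σ.injective.ne h)

lemma Counter.relabel_injective {m : ℕ} (σ : Equiv.Perm (Fin m)) :
    Function.Injective (Counter.relabel σ) := by
  rintro (_ | ⟨i, j, h⟩) (_ | ⟨i', j', h'⟩) hf <;> simp_all [Counter.relabel]

lemma Counter.rate_relabel {m : ℕ} (σ : Equiv.Perm (Fin m)) (lamS lamE : ℝ≥0) (c : Counter m) :
    (c.relabel σ).rate lamS lamE = c.rate lamS lamE := by
  cases c <;> rfl

namespace Network

variable {n s m : ℕ} {lamS lamE : ℝ≥0} {Ω : Type u} [MeasurableSpace Ω] {μ : Measure Ω}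
  (G : Network n s m lamS lamE μ) {k : ℕ} {j : Fin m}

/-- The network in which node `σ i` is called `i`. -/
def relabel (σ : Equiv.Perm (Fin m)) : Network n s m lamS lamE μ where
  subscribers := G.subscribers.map σ.symm.toEmbedding
  card_subscribers := by rw [Finset.card_map, G.card_subscribers]
  counter c := G.counter (c.relabel σ)
  selected ℓ ω := (G.selected ℓ ω).map σ.symm.toEmbedding
  poisson c := by
    rw [← Counter.rate_relabel σ]
    exact G.poisson _
  measurable_selected ℓ := (Measurable.of_discrete
    (f := fun K : Finset (Fin m) => K.map σ.symm.toEmbedding)).comp (G.measurable_selected ℓ)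
  law_selected ℓ := by
    have hm : Measurable fun K : Finset (Fin m) => K.map σ.symm.toEmbedding :=
      Measurable.of_discrete
    refine ⟨(hm.comp (G.measurable_selected ℓ)).aemeasurable, ?_⟩
    have h1 := (G.law_selected ℓ).map_eq
    have h2 := Measure.map_map (μ := μ) hm (G.measurable_selected ℓ)
    rw [h1, map_uniformOn hm (Finset.map_injective _) (Set.toFinite _)] at h2
    refine h2.symm.trans ?_
    congr 1
    ext K
    simp only [Set.mem_image, Finset.mem_coe, Finset.mem_powersetCard]
    constructor
    · rintro ⟨K, ⟨h3, h4⟩, rfl⟩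
      refine ⟨fun i hi => ?_, by rwa [Finset.card_map]⟩
      simp only [Finset.mem_map_equiv, Equiv.symm_symm, Finset.mem_compl] at hi ⊢
      simpa using h3 hi
    · rintro ⟨h3, h4⟩
      refine ⟨K.map σ.toEmbedding, ⟨fun i hi => ?_, by rwa [Finset.card_map]⟩, ?_⟩
      · rw [Finset.mem_map_equiv] at hi
        simpa [Finset.mem_map_equiv] using h3 hi
      · ext i
        simp [Finset.mem_map_equiv]
  indep_counters := G.indep_counters.precomp (Counter.relabel_injective σ)
  indep_selected := G.indep_selected.comp
    (fun _ (K : Finset (Fin m)) => K.map σ.symm.toEmbedding) fun _ => Measurable.of_discrete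
  indep_counters_selected := G.indep_counters_selected.comp
    (φ := fun (N : Path m) (c : Counter m) => N (c.relabel σ))
    (ψ := fun (H : ℕ → Finset (Fin m)) (ℓ : ℕ) => (H ℓ).map σ.symm.toEmbedding)
    (measurable_pi_lambda _ fun c => measurable_pi_apply _)
    (measurable_pi_lambda _ fun ℓ => (Measurable.of_discrete
      (f := fun K : Finset (Fin m) => K.map σ.symm.toEmbedding)).comp (measurable_pi_apply ℓ))

lemma path_relabel (σ : Equiv.Perm (Fin m)) (ω : Ω) :
    (G.relabel σ).path ω = (G.path ω).relabel σ := by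
  funext c
  cases c <;> rfl

lemma meanAge_relabel (σ : Equiv.Perm (Fin m)) (t : ℝ≥0) :
    (G.relabel σ).meanAge k j t = G.meanAge k (σ j) t := by
  refine lintegral_congr fun ω => ?_
  rw [pathAge, path_relabel, Path.versionAge_relabel, pathAge]
  congr 2
  funext ℓ
  ext i
  simp [holders, keyHolders, relabel, Finset.mem_map_equiv]

/-- The limit age depends only on the parameters and on whether the node is a subscriber. -/
theorem limitAge_congr [IsProbabilityMeasure μ] {Ω' : Type u} [MeasurableSpace Ω']
    {μ' : Measure Ω'} [IsProbabilityMeasure μ'] (G : Network n s m lamS lamE μ)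
    (G' : Network n s m lamS lamE μ') {j j' : Fin m}
    (hj : j ∈ G.subscribers ↔ j' ∈ G'.subscribers) : G.limitAge k j = G'.limitAge k j' := by
  obtain ⟨σ, h1, h2⟩ := exists_perm (G.card_subscribers.trans G'.card_subscribers.symm) hj
  refine iSup_congr fun t => ?_
  rw [← h1, ← meanAge_relabel]
  refine meanAge_congr _ _ ?_ k j t
  ext i
  rw [← h2]
  simp [relabel, Finset.mem_map_equiv]

/-- The network with the same counters, in which the key holders are always the members of `S`. -/
def fixed (S : Finset (Fin m)) {r : ℕ} (hS : S.card = r) [IsProbabilityMeasure μ] :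
    Network r r m lamS lamE μ where
  subscribers := S
  card_subscribers := hS
  counter := G.counter
  selected _ _ := ∅
  poisson := G.poisson
  measurable_selected _ := measurable_const
  law_selected ℓ := by
    have : (uniformOn (↑(Finset.powersetCard (r - r) Sᶜ) : Set (Finset (Fin m)))) =
        Measure.dirac ∅ := by
      rw [Nat.sub_self, Finset.powersetCard_zero, Finset.coe_singleton]
      ext t ht
      rw [uniformOn_singleton, Measure.dirac_apply' _ ht]
      rfl
    rw [this]
    exact hasLaw_dirac_of_ae_eq (ae_of_all _ fun _ => rfl)
  indep_counters := G.indep_counters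
  indep_selected := G.indep_selected.comp (fun _ _ => ∅) fun _ => measurable_const
  indep_counters_selected := G.indep_counters_selected.comp
    (φ := fun N : Path m => N) (ψ := fun (_ : ℕ → Finset (Fin m)) (_ : ℕ) => (∅ : Finset (Fin m)))
    measurable_id measurable_const

lemma holders_fixed [IsProbabilityMeasure μ] (S : Finset (Fin m)) {r : ℕ} (hS : S.card = r)
    (ω : Ω) : (G.fixed S hS).holders ω = fun _ => S := by
  funext ℓ
  simp [holders, keyHolders, fixed]

/-- The age is smallest when all the nodes are subscribers. -/
lemma limitAge_fixed_univ_le [IsProbabilityMeasure μ] {r : ℕ}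
    (hr : (Finset.univ : Finset (Fin m)).card = r) :
    (G.fixed Finset.univ hr).limitAge k j ≤ G.limitAge k j := by
  refine iSup_mono fun t => lintegral_mono fun ω => ?_
  refine Nat.cast_le.2 ?_
  rw [pathAge, holders_fixed]
  exact Path.versionAge_anti_holders fun ℓ _ => Finset.subset_univ _

/-- With key holders `K`, version `ℓ` has been generated and cannot be decoded by `j` at time
`t`. -/
def undecoded (k : ℕ) (j : Fin m) (t : ℝ≥0) (ℓ : ℕ) (K : Finset (Fin m)) : Set (Path m) :=
  {N | (1 ≤ ℓ ∧ ℓ ≤ N .source t) ∧ ¬ Path.Decodes k j N (fun _ => K) t ℓ}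

lemma measurableSet_undecoded (t : ℝ≥0) (ℓ : ℕ) (K : Finset (Fin m)) :
    MeasurableSet (undecoded k j t ℓ K) := by
  have h : Measurable fun N : Path m => ((N, fun _ => K) : Path m × (ℕ → Finset (Fin m))) :=
    measurable_id.prodMk measurable_const
  exact ((MeasurableSet.const _).inter (measurableSet_le measurable_const
    (Path.measurable_eval _ _))).inter (h (Path.measurableSet_decodes k j t ℓ)).compl

lemma card_undecoded (N : Path m) (H : ℕ → Finset (Fin m)) (t : ℝ≥0) :
    ((((Finset.Icc 1 (N .source t)).filter fun ℓ => ¬ Path.Decodes k j N H t ℓ).card : ℕ) : ℝ≥0∞) =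
      ∑' ℓ, if N ∈ undecoded k j t ℓ (H ℓ) then 1 else 0 := by
  rw [tsum_eq_sum (s := (Finset.Icc 1 (N .source t)).filter fun ℓ => ¬ Path.Decodes k j N H t ℓ),
    Finset.sum_congr rfl (g := fun _ => (1 : ℝ≥0∞))]
  · simp
  · intro ℓ hℓ
    rw [if_pos]
    simpa [undecoded, Path.Decodes] using hℓ
  · intro ℓ hℓ
    rw [if_neg]
    simpa [undecoded, Path.Decodes] using hℓ

lemma measurableSet_path_undecoded (t : ℝ≥0) (ℓ : ℕ) :
    MeasurableSet {ω | G.path ω ∈ undecoded k j t ℓ (G.holders ω ℓ)} := by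
  have : {ω | G.path ω ∈ undecoded k j t ℓ (G.holders ω ℓ)} =
      ⋃ K : Finset (Fin m), (G.keyHolders ℓ ⁻¹' {K}) ∩ (G.path ⁻¹' undecoded k j t ℓ K) := by
    ext ω
    simp [holders]
  rw [this]
  exact MeasurableSet.iUnion fun K => (G.measurable_keyHolders ℓ (measurableSet_singleton K)).inter
    (G.measurable_path (measurableSet_undecoded t ℓ K))

lemma lintegral_tsum_undecoded (t : ℝ≥0) :
    ∫⁻ ω, ∑' ℓ, (if G.path ω ∈ undecoded k j t ℓ (G.holders ω ℓ) then (1 : ℝ≥0∞) else 0) ∂μ =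
      ∑' ℓ, μ {ω | G.path ω ∈ undecoded k j t ℓ (G.holders ω ℓ)} := by
  rw [lintegral_tsum fun ℓ => (Measurable.ite (G.measurableSet_path_undecoded t ℓ)
    measurable_const measurable_const).aemeasurable]
  refine tsum_congr fun ℓ => ?_
  have := lintegral_indicator_one (μ := μ) (G.measurableSet_path_undecoded (k := k) (j := j) t ℓ)
  simpa [Set.indicator_apply] using this

lemma meanAge_le_tsum (t : ℝ≥0) :
    G.meanAge k j t ≤ ∑' ℓ, μ {ω | G.path ω ∈ undecoded k j t ℓ (G.holders ω ℓ)} := by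
  rw [← lintegral_tsum_undecoded]
  refine lintegral_mono fun ω => ?_
  simp only
  rw [← card_undecoded]
  exact Nat.cast_le.2 Path.versionAge_le_card

/-- For constant holders no version below the latest decoded one is undecoded, so the estimate in
`meanAge_le_tsum` can be reversed. -/
lemma tsum_le_meanAge_fixed [IsProbabilityMeasure μ] (S : Finset (Fin m)) {r : ℕ}
    (hS : S.card = r) (t : ℝ≥0) :
    ∑' ℓ, μ {ω | G.path ω ∈ undecoded k j t ℓ S} ≤ (G.fixed S hS).meanAge k j t := by
  have h := (G.fixed S hS).lintegral_tsum_undecoded (k := k) (j := j) t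
  simp only [holders_fixed] at h
  refine h.symm.le.trans (lintegral_mono fun ω => ?_)
  simp only
  rw [← card_undecoded (H := fun _ => S), pathAge, holders_fixed]
  exact Nat.cast_le.2 (Path.card_le_versionAge S)

/-- The probability that a version cannot be decoded by `j` is the same for all sets of key
holders of the same size that do not contain `j`. -/
lemma measure_undecoded_eq [IsProbabilityMeasure μ] {K S : Finset (Fin m)} (hKS : S.card = K.card)
    (hjK : j ∉ K) (hjS : j ∉ S) (t : ℝ≥0) (ℓ : ℕ) :
    μ {ω | G.path ω ∈ undecoded k j t ℓ K} = μ {ω | G.path ω ∈ undecoded k j t ℓ S} := by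
  obtain ⟨σ, h1, h2⟩ := exists_perm hKS (iff_of_false hjS hjK)
  have hlaw : μ.map (G.relabel σ).path = μ.map G.path :=
    map_path_eq (G.relabel σ).poisson G.poisson (G.relabel σ).indep_counters G.indep_counters
  have hm := measurableSet_undecoded (k := k) (j := j) t ℓ S
  have e1 := Measure.map_apply (μ := μ) G.measurable_path hm
  have e2 := Measure.map_apply (μ := μ) (G.relabel σ).measurable_path hm
  rw [hlaw, e1] at e2
  refine Eq.trans ?_ e2.symm
  congr 1
  ext ω
  have hK : S.map σ.toEmbedding = K := by
    ext i
    rw [Finset.mem_map_equiv, ← h2, Equiv.apply_symm_apply]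
  simp only [undecoded, Set.mem_ofPred_eq, Set.mem_preimage, path_relabel, Path.decodes_relabel,
    hK, h1]
  rfl

/-- A set of key holders that does not contain `j` is the least favourable for `j`. -/
lemma measure_undecoded_le [IsProbabilityMeasure μ] {K S : Finset (Fin m)} (hKS : S.card = K.card)
    (hjS : j ∉ S) (t : ℝ≥0) (ℓ : ℕ) :
    μ {ω | G.path ω ∈ undecoded k j t ℓ K} ≤ μ {ω | G.path ω ∈ undecoded k j t ℓ S} := by
  by_cases hjK : j ∈ K
  -- Exchange `j` for a node `i` outside `K`, which exists since `S` has the same size and misses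
  -- `j`. This loses the key that `j` holds at once and gains at most one other.
  · obtain ⟨i, hi⟩ : ∃ i, i ∉ K := by
      by_contra! hall
      have hK : K = Finset.univ := Finset.eq_univ_iff_forall.2 hall
      rw [hK] at hKS
      exact hjS (by rw [(Finset.card_eq_iff_eq_univ S).1 (by simpa using hKS)]; simp)
    have hij : i ≠ j := fun h => hi (h ▸ hjK)
    have hcard : (insert i (K.erase j)).card = K.card := by
      rw [Finset.card_insert_of_notMem (fun h => hi (Finset.mem_of_mem_erase h)),
        Finset.card_erase_add_one hjK]
    rw [← G.measure_undecoded_eq (K := insert i (K.erase j)) (hKS.trans hcard.symm)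
      (by simp [hij.symm]) hjS]
    refine measure_mono fun ω hω => ⟨hω.1, fun h => hω.2 (le_trans h ?_)⟩
    have hsub : insert i (K.erase j) ∩ (G.path ω).reaching ℓ t j ⊆
        insert i ((K ∩ (G.path ω).reaching ℓ t j).erase j) := by
      intro x hx
      simp only [Finset.mem_inter, Finset.mem_insert, Finset.mem_erase] at hx ⊢
      tauto
    have hj : j ∈ K ∩ (G.path ω).reaching ℓ t j :=
      Finset.mem_inter.2 ⟨hjK, Path.mem_reaching.2 (Or.inl rfl)⟩
    exact (Finset.card_le_card hsub).trans ((Finset.card_insert_le _ _).trans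
      (Finset.card_erase_add_one hj).le)
  · exact (G.measure_undecoded_eq hKS hjK hjS t ℓ).le

lemma indepFun_path_selected (ℓ : ℕ) : IndepFun G.path (G.selected ℓ) μ :=
  G.indep_counters_selected.comp (φ := id) (ψ := fun H : ℕ → Finset (Fin m) => H ℓ)
    measurable_id (measurable_pi_apply ℓ)

/-- Decompose by the selected set, which is independent of the counters. Each possible outcome gives
`n` holders, so the fixed-set bound applies to every term, and the selection probabilities sum to at
most one. -/
lemma measure_undecoded_holders_le [IsProbabilityMeasure μ] (hsn : s ≤ n) {S : Finset (Fin m)}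
    (hS : S.card = n) (hjS : j ∉ S) (t : ℝ≥0) (ℓ : ℕ) :
    μ {ω | G.path ω ∈ undecoded k j t ℓ (G.holders ω ℓ)} ≤
      μ {ω | G.path ω ∈ undecoded k j t ℓ S} := by
  have hsub : {ω | G.path ω ∈ undecoded k j t ℓ (G.holders ω ℓ)} ⊆
      ⋃ K : Finset (Fin m), (G.path ⁻¹' undecoded k j t ℓ (G.subscribers ∪ K)) ∩
        (G.selected ℓ ⁻¹' {K}) := by
    intro ω hω
    simp only [Set.mem_iUnion]
    exact ⟨G.selected ℓ ω, hω, rfl⟩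
  refine (measure_mono hsub).trans ((measure_iUnion_fintype_le _ _).trans ?_)
  have hK : ∀ K : Finset (Fin m), μ ((G.path ⁻¹' undecoded k j t ℓ (G.subscribers ∪ K)) ∩
      (G.selected ℓ ⁻¹' {K})) ≤
      μ {ω | G.path ω ∈ undecoded k j t ℓ S} * μ (G.selected ℓ ⁻¹' {K}) := by
    intro K
    rw [(G.indepFun_path_selected ℓ).measure_inter_preimage_eq_mul _ _
      (measurableSet_undecoded t ℓ _) (measurableSet_singleton K)]
    by_cases hKm : K ∈ Finset.powersetCard (n - s) G.subscribersᶜ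
    · have hKc := Finset.mem_powersetCard.1 hKm
      refine mul_le_mul' (G.measure_undecoded_le ?_ hjS t ℓ) le_rfl
      rw [Finset.card_union_of_disjoint, G.card_subscribers, hKc.2, hS]
      · omega
      · exact (disjoint_compl_right (a := G.subscribers)).mono_right hKc.1
    · have h0 : μ (G.selected ℓ ⁻¹' {K}) = 0 := by
        refine measure_mono_null ?_ (ae_iff.1 (G.ae_selected_mem ℓ))
        intro ω hω h
        rw [Set.mem_preimage, Set.mem_singleton_iff] at hω
        exact hKm (hω ▸ h)
      rw [h0, mul_zero, mul_zero]
  refine (Finset.sum_le_sum fun K _ => hK K).trans ?_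
  rw [← Finset.mul_sum, sum_measure_preimage_singleton _ fun K _ =>
    G.measurable_selected ℓ (measurableSet_singleton K)]
  exact mul_le_of_le_one_right' prob_le_one

/-- The age is at most that of a node without keys in a network where all the keys go to fixed
nodes. -/
lemma limitAge_le_fixed [IsProbabilityMeasure μ] (hsn : s ≤ n) {S : Finset (Fin m)}
    (hS : S.card = n) (hjS : j ∉ S) : G.limitAge k j ≤ (G.fixed S hS).limitAge k j :=
  iSup_mono fun t => (G.meanAge_le_tsum t).trans
    ((ENNReal.tsum_le_tsum fun ℓ => G.measure_undecoded_holders_le hsn hS hjS t ℓ).trans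
      (G.tsum_le_meanAge_fixed S hS t))

/-- By `limitAge_congr`, the constant computed in one network serves every network with the same
parameters. -/
lemma isSubscriberAge [IsProbabilityMeasure μ] (hsn : s ≤ n) (hkn : k < n) (hnm : 2 ≤ m)
    (hE : 0 < lamE) (hj : j ∈ G.subscribers) :
    IsSubscriberAge.{u} k n s m lamS lamE (G.limitAge k j).toReal := by
  intro Ω' _ μ' _ G' j' hj'
  rw [limitAge_congr G G' (iff_of_true hj hj')]
  exact G'.hasTimeAverageAge hsn hkn hnm hE

lemma isNonsubscriberAge [IsProbabilityMeasure μ] (hsn : s ≤ n) (hkn : k < n) (hnm : 2 ≤ m)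
    (hE : 0 < lamE) (hj : j ∉ G.subscribers) :
    IsNonsubscriberAge.{u} k n s m lamS lamE (G.limitAge k j).toReal := by
  intro Ω' _ μ' _ G' j' hj'
  rw [limitAge_congr G G' (iff_of_false hj hj')]
  exact G'.hasTimeAverageAge hsn hkn hnm hE

end Network

/-! ### Assembling the theorem -/

lemma graphAverage_mem_Icc {s m : ℕ} (hm : 0 < m) (hsm : s ≤ m) {a b lo hi : ℝ}
    (ha : a ∈ Set.Icc lo hi) (hb : b ∈ Set.Icc lo hi) :
    graphAverage s m a b ∈ Set.Icc lo hi := by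
  have hm' : (0 : ℝ) < m := by exact_mod_cast hm
  have hs' : (s : ℝ) ≤ m := by exact_mod_cast hsm
  exact (convex_Icc lo hi) ha hb (by positivity) (div_nonneg (by linarith) hm'.le)
    (by field_simp; ring)

end Gossip

end

theorem mainTheorem2 (k n s m : ℕ) (hkn : k < n) (hsn : s < n) (hnm : n < m)
    (lamS lamE : ℝ≥0) (hS : 0 < lamS) (hE : 0 < lamE) :
    ∃ ageFull ageSub ageNonsub ageTotal : ℝ,
      Gossip.IsSubscriberAge.{u} k m m m lamS lamE ageFull ∧
      Gossip.IsSubscriberAge.{u} k n s m lamS lamE ageSub ∧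
      Gossip.IsNonsubscriberAge.{u} k n s m lamS lamE ageNonsub ∧
      Gossip.IsNonsubscriberAge.{u} k n n m lamS lamE ageTotal ∧
      ageFull ≤ Gossip.graphAverage s m ageSub ageNonsub ∧
      Gossip.graphAverage s m ageSub ageNonsub ≤ ageTotal := by
  have hm2 : 2 ≤ m := by omega
  have hm0 : 0 < m := by omega
  have hcard : (Finset.univ : Finset (Fin m)).card = m := by simp
  -- Ages are defined by a statement about all networks, so no network needs to be constructed. If
  -- there is no fully subscribed one there is none on `m` nodes at all, since `fixed` turns any
  -- network into it; every age statement is then vacuous.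
  by_cases hF : ∃ (Ω : Type u) (_ : MeasurableSpace Ω) (μ : Measure Ω) (_ : IsProbabilityMeasure μ),
      Nonempty (Gossip.Network m m m lamS lamE μ)
  · obtain ⟨Ω, _, μ, _, ⟨F⟩⟩ := hF
    let i : Fin m := ⟨0, hm0⟩
    have hFi : ∀ (Ω : Type u) [MeasurableSpace Ω] (μ : Measure Ω) [IsProbabilityMeasure μ]
        (F : Gossip.Network m m m lamS lamE μ) (j : Fin m), j ∈ F.subscribers := by
      intro Ω _ μ _ F j
      rw [(Finset.card_eq_iff_eq_univ F.subscribers).1 (by simpa using F.card_subscribers)]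
      exact Finset.mem_univ j
    have hex : ∀ j : Fin m, ∃ S : Finset (Fin m), S.card = n ∧ j ∉ S := by
      intro j
      obtain ⟨S, hS1, hS2⟩ := Finset.exists_subset_card_eq
        (s := Finset.univ.erase j) (n := n) (by
          rw [Finset.card_erase_of_mem (Finset.mem_univ j), hcard]
          omega)
      exact ⟨S, hS2, fun h => by simpa using hS1 h⟩
    obtain ⟨S, hSn, hiS⟩ := hex i
    let T := F.fixed S hSn
    have hTtop := T.limitAge_ne_top (j := i) le_rfl hkn hm2 hE
    have hlo : ∀ (Ω' : Type u) [MeasurableSpace Ω'] (μ' : Measure Ω') [IsProbabilityMeasure μ']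
        (n' s' : ℕ) (G : Gossip.Network n' s' m lamS lamE μ') (j : Fin m),
        F.limitAge k i ≤ G.limitAge k j := by
      intro Ω' _ μ' _ n' s' G j
      -- `F` and `G` may live on different spaces; `F` is replaced by the fully subscribed network
      -- on the counters of `G`, where the comparison is pathwise.
      rw [Gossip.Network.limitAge_congr F (G.fixed Finset.univ hcard) (j' := j)
        (iff_of_true (hFi _ _ F i) (hFi _ _ (G.fixed Finset.univ hcard) j))]
      exact G.limitAge_fixed_univ_le hcard
    have hhi : ∀ (Ω' : Type u) [MeasurableSpace Ω'] (μ' : Measure Ω') [IsProbabilityMeasure μ']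
        (G : Gossip.Network n s m lamS lamE μ') (j : Fin m),
        G.limitAge k j ≤ T.limitAge k i := by
      intro Ω' _ μ' _ G j
      obtain ⟨S', hS', hj⟩ := hex j
      rw [Gossip.Network.limitAge_congr T (G.fixed S' hS') (iff_of_false hiS hj)]
      exact G.limitAge_le_fixed hsn.le hS' hj
    have hFT := ENNReal.toReal_mono hTtop (hlo Ω μ n n T i)
    have hFsub := F.isSubscriberAge le_rfl (hkn.trans hnm) hm2 hE (hFi Ω μ F i)
    have hTnon := T.isNonsubscriberAge le_rfl hkn hm2 hE hiS
    by_cases hG : ∃ (Ω : Type u) (_ : MeasurableSpace Ω) (μ : Measure Ω)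
        (_ : IsProbabilityMeasure μ), Nonempty (Gossip.Network n s m lamS lamE μ)
    · obtain ⟨Ω', _, μ', _, ⟨G⟩⟩ := hG
      have hmem : ∀ j, (G.limitAge k j).toReal ∈
          Set.Icc (F.limitAge k i).toReal (T.limitAge k i).toReal := fun j =>
        ⟨ENNReal.toReal_mono (G.limitAge_ne_top hsn.le hkn hm2 hE) (hlo Ω' μ' n s G j),
          ENNReal.toReal_mono hTtop (hhi Ω' μ' G j)⟩
      obtain ⟨b, hb⟩ : ∃ b, b ∉ G.subscribers := by
        by_contra! hall
        have h1 := G.card_subscribers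
        rw [Finset.eq_univ_iff_forall.2 hall, hcard] at h1
        omega
      have hGnon := G.isNonsubscriberAge (k := k) hsn.le hkn hm2 hE hb
      obtain ⟨x, hx, hGsub⟩ : ∃ x ∈ Set.Icc (F.limitAge k i).toReal (T.limitAge k i).toReal,
          Gossip.IsSubscriberAge.{u} k n s m lamS lamE x := by
        rcases G.subscribers.eq_empty_or_nonempty with h0 | ⟨a, ha⟩
        -- For `s = 0` there is no subscriber, and any value in the interval serves as subscriber
        -- age.
        · refine ⟨_, hmem b, fun Ω'' _ μ'' _ G'' j hj => ?_⟩
          have h1 := G.card_subscribers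
          rw [h0, Finset.card_empty] at h1
          have h2 := G''.card_subscribers
          have h3 := Finset.card_pos.2 ⟨j, hj⟩
          omega
        · exact ⟨_, hmem a, G.isSubscriberAge hsn.le hkn hm2 hE ha⟩
      have hav := Gossip.graphAverage_mem_Icc hm0 (hsn.trans hnm).le hx (hmem b)
      exact ⟨_, _, _, _, hFsub, hGsub, hGnon, hTnon, hav.1, hav.2⟩
    · have hno : ∀ (Ω : Type u) [MeasurableSpace Ω] (μ : Measure Ω) [IsProbabilityMeasure μ],
          Gossip.Network n s m lamS lamE μ → False :=
        fun Ω hΩ μ hμ G => hG ⟨Ω, hΩ, μ, hμ, ⟨G⟩⟩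
      -- Without `(n, s, m)` networks both of their ages are arbitrary, and are taken equal to the
      -- lower bound.
      have hx : (F.limitAge k i).toReal ∈
          Set.Icc (F.limitAge k i).toReal (T.limitAge k i).toReal := ⟨le_rfl, hFT⟩
      have hav := Gossip.graphAverage_mem_Icc hm0 (hsn.trans hnm).le hx hx
      exact ⟨_, _, _, _, hFsub, fun Ω _ μ _ G => (hno Ω μ G).elim,
        fun Ω _ μ _ G => (hno Ω μ G).elim, hTnon, hav.1, hav.2⟩
  · have hno : ∀ (Ω : Type u) [MeasurableSpace Ω] (μ : Measure Ω) [IsProbabilityMeasure μ]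
        (n' s' : ℕ), Gossip.Network n' s' m lamS lamE μ → False :=
      fun Ω hΩ μ hμ n' s' G => hF ⟨Ω, hΩ, μ, hμ, ⟨G.fixed Finset.univ hcard⟩⟩
    refine ⟨0, 0, 0, 0, fun Ω _ μ _ G => (hno Ω μ _ _ G).elim,
      fun Ω _ μ _ G => (hno Ω μ _ _ G).elim, fun Ω _ μ _ G => (hno Ω μ _ _ G).elim,
      fun Ω _ μ _ G => (hno Ω μ _ _ G).elim, ?_, ?_⟩ <;> simp [Gossip.graphAverage]
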